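/- Let $G=(V,E)$ be a finite graph without self-loops, possibly with multiple edges, such that $G$ is 3-connected (it remains connected after the removal of any set of fewer than three vertices), every vertex $i$ has even degree $d(i)\ge 6$ (counting multiplicity), and any pair of vertices is joined by at most two edges. Orient the edges arbitrarily, put $\epsilon_{e,j}=1$ if $j$ is the head of the edge $e$ and $\epsilon_{e,j}=-1$ if $j$ is its tail, and label the edges incident to each vertex $i$ arbitrarily by $1,\dots,d(i)$. Place $d(i)/2$ qubits at each vertex $i$. *Local Majorana modes* are Hermitian Pauli operators $\gamma_{i,1},\dots,\gamma_{i,d(i)}$ ($i\in V$) acting only on the qubits at $i$, which generate, up to phases, all Pauli operators on these qubits and satisfy $\gamma_{i,p}\gamma_{i,q}+\gamma_{i,q}\gamma_{i,p}=2\delta_{p,q}I$. Given such modes, let $\tilde B_i=(-\mathrm{i})^{d(i)/2}\gamma_{i,1}\cdots\gamma_{i,d(i)}$, and, for an edge $e$ traversed from $j$ to $k$ with label $p$ at $j$ and $q$ at $k$, let $\tilde A_{e,j\to k}=\epsilon_{e,j}\gamma_{j,p}\gamma_{k,q}$. For a closed walk $\zeta$ with successive traversed edges $e_1,\dots,e_s$,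 let $\tilde A(\zeta)=\mathrm{i}^s\tilde A_{e_1}\cdots\tilde A_{e_s}$. Let $\mathcal S$ be the group generated by all $\tilde A(\zeta)$, and $\mathcal L$ the joint $+1$ eigenspace of $\mathcal S$ (the Generalized Superfast Encoding). A *logical operator* is a Pauli operator that commutes with $\mathcal S$ and whose restriction to $\mathcal L$ is not a multiple of the identity. The code *corrects all single-qubit errors* if every logical operator has weight at least $3$ (acts non-trivially on at least three qubits). (1) For all local Majorana modes such that, for all $i\in V$ and $1\le p<q\le d(i)$ (and, in the conditions on a single mode, all $1\le p\le d(i)$), $$|\tilde B_i|\ge 3,\qquad |\gamma_{i,p}|\ge 2,\qquad |\tilde B_i\gamma_{i,p}|\ge 2,\qquad |\tilde B_i\gamma_{i,p}\gamma_{i,q}|\ge 2,$$ where $|\cdot|$ denotes the weight, $\mathcal S$ is an abelian group of Pauli operators with $-I\notin\mathcal S$, and the resulting stabilizer code corrects all single-qubit errors. (2) Such modes exist. Explicitly, at a vertex of degree $d=2n$, number the qubits cyclically by $0,\dots,n-1$; for $0\le r<n$ put $a=(\lfloor n/2\rfloor+r)\bmod n$, and let $\gamma_{i,2r+1}$ and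 $\gamma_{i,2r+2}$ have $X$ and $Y$, respectively, on qubit $a$, have $Z$ on the $m$ qubits cyclically preceding $a$, and the identity on all others, where $m=(n-1)/2$ if $n$ is odd, $m=n/2$ if $n$ is even and $a\ge n/2$, and $m=n/2-1$ if $n$ is even and $a<n/2$. These are local Majorana modes satisfying the conditions in (1), so the stabilizer code that they define corrects all single-qubit errors. -/

import Mathlib

namespace GSE

/-! ### Qubits and Pauli operators -/

/-- Labels of the four single-qubit Pauli matrices. -/
inductive Pauli where
  | I | X | Y | Z
  deriving DecidableEq

/-- The `2 × 2` Pauli matrices. -/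
def Pauli.mat : Pauli → Matrix (Fin 2) (Fin 2) ℂ
  | .I => !![1, 0; 0, 1]
  | .X => !![0, 1; 1, 0]
  | .Y => !![0, -Complex.I; Complex.I, 0]
  | .Z => !![1, 0; 0, -1]

/-- Linear operators on the Hilbert space of the qubits in `Q`, as matrices in the standard basis. -/
abbrev Op (Q : Type*) := Matrix (Q → Fin 2) (Q → Fin 2) ℂ

/-- The tensor product of the Pauli matrices `P q`, `q : Q`. -/
def pauliOp {Q : Type*} [Fintype Q] (P : Q → Pauli) : Op Q :=
  Matrix.of fun a b => ∏ q, (P q).mat (a q) (b q)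

/-- Pauli operators: tensor products of Pauli matrices times a phase in `{1, i, -1, -i}`. -/
def IsPauli {Q : Type*} [Fintype Q] (O : Op Q) : Prop :=
  ∃ (c : ℂ) (P : Q → Pauli), c ^ 4 = 1 ∧ O = c • pauliOp P

/-- Pauli operators that act as the identity outside the set `A` of qubits. -/
def IsPauliOn {Q : Type*} [Fintype Q] (A : Set Q) (O : Op Q) : Prop :=
  ∃ (c : ℂ) (P : Q → Pauli), c ^ 4 = 1 ∧ (∀ q, q ∉ A → P q = .I) ∧ O = c • pauliOp P

/-- `O` acts trivially on the qubit `q`: it is the identity on `q`, tensored with an operator on the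
other qubits. -/
def ActsTrivially {Q : Type*} (O : Op Q) (q : Q) : Prop :=
  ∃ O' : Op {r : Q // r ≠ q}, ∀ a b : Q → Fin 2,
    O a b = if a q = b q then O' (fun r => a r) (fun r => b r) else 0

/-- The weight of an operator: the number of qubits on which it acts non-trivially. -/
noncomputable def weight {Q : Type*} (O : Op Q) : ℕ :=
  {q : Q | ¬ ActsTrivially O q}.ncard

/-! ### Stabilizer codes -/

/-- `S` is a stabilizer group: an abelian group of Pauli operators that does not contain `-I`. -/
def IsStabilizerGroup {Q : Type*} [Fintype Q] [DecidableEq Q] (S : Subgroup (Op Q)ˣ) : Prop :=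
  (∀ s ∈ S, IsPauli (s : Op Q)) ∧ (∀ s ∈ S, ∀ t ∈ S, s * t = t * s) ∧ (-1 : (Op Q)ˣ) ∉ S

/-- The codespace: the joint `+1` eigenspace of the elements of `S`. -/
def codespace {Q : Type*} [Fintype Q] [DecidableEq Q] (S : Subgroup (Op Q)ˣ) :
    Submodule ℂ ((Q → Fin 2) → ℂ) where
  carrier := {ψ | ∀ s ∈ S, (s : Op Q).mulVec ψ = ψ}
  add_mem' := fun {ψ φ} hψ hφ s hs => by rw [Matrix.mulVec_add, hψ s hs, hφ s hs]
  zero_mem' := fun s _ => Matrix.mulVec_zero _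
  smul_mem' := fun c ψ hψ s hs => by rw [Matrix.mulVec_smul, hψ s hs]

/-- Logical operators: Pauli operators that commute with `S` and whose restriction to the codespace
is not a multiple of the identity. -/
def IsLogical {Q : Type*} [Fintype Q] [DecidableEq Q] (S : Subgroup (Op Q)ˣ) (O : Op Q) : Prop :=
  IsPauli O ∧ (∀ s ∈ S, O * (s : Op Q) = (s : Op Q) * O) ∧
    ¬ ∃ c : ℂ, ∀ ψ ∈ codespace S, O.mulVec ψ = c • ψ

/-- The code corrects all single-qubit errors: every logical operator has weight at least three. -/
def CorrectsSingleQubitErrors {Q : Type*} [Fintype Q] [DecidableEq Q]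
    (S : Subgroup (Op Q)ˣ) : Prop :=
  ∀ O : Op Q, IsLogical S O → 3 ≤ weight O

/-! ### Interaction graphs -/

/-- A multigraph without self-loops, with vertices `V` and edges `E`, each edge being oriented. -/
structure Multigraph (V E : Type*) where
  /-- the tail of an edge -/
  tail : E → V
  /-- the head of an edge -/
  head : E → V
  /-- there are no self-loops -/
  tail_ne_head : ∀ e, tail e ≠ head e

namespace Multigraph

variable {V E : Type*} (G : Multigraph V E)

/-- The vertex `i` is an endpoint of `e`. -/
def Inc (e : E) (i : V) : Prop := G.tail e = i ∨ G.head e = i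

/-- The edge `e` connects `i` and `j`, in either orientation. -/
def Joins (e : E) (i j : V) : Prop :=
  (G.tail e = i ∧ G.head e = j) ∨ (G.head e = i ∧ G.tail e = j)

theorem Joins.inc_left {G : Multigraph V E} {e : E} {i j : V} (h : G.Joins e i j) : G.Inc e i :=
  h.elim (fun h => Or.inl h.1) (fun h => Or.inr h.1)

theorem Joins.inc_right {G : Multigraph V E} {e : E} {i j : V} (h : G.Joins e i j) : G.Inc e j :=
  h.elim (fun h => Or.inr h.2) (fun h => Or.inl h.2)

/-- The degree of a vertex: the number of incident edges, counted with multiplicity. -/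
noncomputable def degree (i : V) : ℕ := Nat.card {e : E // G.Inc e i}

/-- The underlying simple graph: distinct vertices are adjacent when some edge connects them. -/
def toSimple : SimpleGraph V where
  Adj i j := ∃ e, G.Joins e i j
  symm := ⟨fun _ _ ⟨e, he⟩ => ⟨e, he.elim (fun h => Or.inr ⟨h.2, h.1⟩) (fun h => Or.inl ⟨h.2, h.1⟩)⟩⟩
  loopless := ⟨fun _ ⟨e, he⟩ =>
    he.elim (fun h => G.tail_ne_head e (h.1.trans h.2.symm))
      (fun h => G.tail_ne_head e (h.2.trans h.1.symm))⟩

/-- `G` remains connected after removal of any set of less than three vertices. -/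
def ThreeConnected : Prop :=
  ∀ T : Finset V, T.card < 3 → (G.toSimple.induce {v | v ∉ T}).Connected

/-- Walks in `G`; parallel edges give different walks. -/
inductive Walk : V → V → Type _
  | nil (u : V) : Walk u u
  | cons {u v w : V} (e : E) (h : G.Joins e u v) (p : Walk v w) : Walk u w

/-- For each vertex `i`, a labelling of the edges incident to `i` by `0, …, d(i) - 1`. -/
def Labelling := (i : V) → Fin (G.degree i) ≃ {e : E // G.Inc e i}

/-- The label at `i` of an edge incident to `i`. -/
def Labelling.label {G : Multigraph V E} (L : G.Labelling) (i : V) (e : E) (h : G.Inc e i) :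
    Fin (G.degree i) :=
  (L i).symm ⟨e, h⟩

/-! ### The Generalized Superfast Encoding -/

/-- There are `d(i)/2` qubits at each vertex `i`. -/
abbrev Qubit := Σ i : V, Fin (G.degree i / 2)

/-- A choice of one operator for every vertex and every label at this vertex. -/
abbrev Modes := (i : V) → Fin (G.degree i) → Op G.Qubit

variable [Fintype V] [DecidableEq V]

/-- The conditions on local Majorana modes: `γ i p` is a Hermitian Pauli operator on the qubits of
`i`, the Majorana commutation rules hold at every vertex, and the modes at `i` generate
(up to phases) all Pauli operators on the qubits of `i`. -/
structure IsLocalMajorana (γ : G.Modes) : Prop where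
  isPauliOn : ∀ i p, IsPauliOn {q : G.Qubit | q.1 = i} (γ i p)
  isHermitian : ∀ i p, (γ i p).IsHermitian
  anticomm : ∀ i p q, γ i p * γ i q + γ i q * γ i p = if p = q then 2 • (1 : Op G.Qubit) else 0
  generate : ∀ i (O : Op G.Qubit), IsPauliOn {q : G.Qubit | q.1 = i} O →
    ∃ (c : ℂ) (M : Op G.Qubit), c ^ 4 = 1 ∧ M ∈ Submonoid.closure (Set.range (γ i)) ∧ O = c • M

variable {G}

/-- The vertex operator `(-i)^{d(j)/2} γ_{j,1} ⋯ γ_{j,d(j)}`. -/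
noncomputable def vertexOp (γ : G.Modes) (j : V) : Op G.Qubit :=
  (-Complex.I) ^ (G.degree j / 2) • (List.ofFn (γ j)).prod

/-- The edge operator `ε_{j,k} γ_{j,p} γ_{k,q}` of the edge `e` traversed from `j` to `k`, where `p`
and `q` are the labels of `e` at `j` and `k`; `ε_{j,k}` is `1` if `j` is the head of `e`, and `-1`
if `j` is the tail. -/
noncomputable def edgeOp (L : G.Labelling) (γ : G.Modes) {j k : V} (e : E) (h : G.Joins e j k) : Op G.Qubit :=
  (if G.head e = j then (1 : ℂ) else -1) •
    (γ j (L.label j e h.inc_left) * γ k (L.label k e h.inc_right))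

/-- The operator of a walk: the product of its edge operators, with a factor `i` for each edge. -/
noncomputable def walkOp (L : G.Labelling) (γ : G.Modes) : {u v : V} → G.Walk u v → Op G.Qubit
  | _, _, .nil _ => 1
  | _, _, .cons e h p => (Complex.I • edgeOp L γ e h) * walkOp L γ p

/-- The group generated by the operators of all closed walks. -/
noncomputable def stabilizer (L : G.Labelling) (γ : G.Modes) : Subgroup (Op G.Qubit)ˣ :=
  Subgroup.closure {s | ∃ (u : V) (ζ : G.Walk u u), (s : Op G.Qubit) = walkOp L γ ζ}

/-- The weight conditions on the local Majorana modes. -/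
structure WeightConditions (γ : G.Modes) : Prop where
  vertex : ∀ i, 3 ≤ weight (vertexOp γ i)
  mode : ∀ i p, 2 ≤ weight (γ i p)
  vertex_mode : ∀ i p, 2 ≤ weight (vertexOp γ i * γ i p)
  vertex_mode_mode : ∀ i p q, p < q → 2 ≤ weight (vertexOp γ i * γ i p * γ i q)

/-- The Pauli matrix on the qubit `t` of the mode with label `p` (both counted from `0`), at a
vertex of even degree `d` with `n = d/2` qubits, numbered cyclically. The modes with labels `2r` and
`2r+1` have `X` and `Y` at position `a = ⌊n/2⌋ + r mod n`, and `Z` at the `(n-1)/2` positions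
cyclically before `a` if `n` is odd; if `n` is even, at the `n/2` positions before `a` when
`a ≥ n/2`, and at the `n/2 - 1` positions before `a` when `a < n/2`. -/
def explicitPauli (d p t : ℕ) : Pauli :=
  let n := d / 2
  let a := (n / 2 + p / 2) % n
  let δ := (a + n - t) % n
  if t = a then (if p % 2 = 0 then .X else .Y)
  else if 2 * δ < n ∨ (2 * δ = n ∧ t < a) then .Z
  else .I

variable (G)

/-- The explicit modes, given by `explicitPauli` on the qubits of `i` and the identity elsewhere. -/
noncomputable def explicitModes : G.Modes := fun i p =>
  pauliOp fun q => if q.1 = i then explicitPauli (G.degree i) p q.2 else .I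

end Multigraph

end GSE

set_option linter.unusedSectionVars false

namespace GSE

/-! ### Labels of Pauli operators as vectors over `ZMod 2` -/

namespace Pauli

/-! Up to phase, a Pauli operator on the qubits `Q` is a vector `Q → Pauli` over `ZMod 2`: products
become sums, commutation is read off the symplectic form `symp`, and the weight is the number of
non-zero entries. The `d` pairwise anticommuting modes at a vertex have Gram matrix `J + 1`, with
`J` the all-ones matrix, which is invertible over `ZMod 2` because `d` is even; with `2 ^ d = 4 ^ (d
/ 2)` they form a basis. So each Pauli label is `comb v x` for a unique assignment `x` of bits to
half-edges.

Stabilizer group: tensor `i` times each edge operator with the product of two Jordan-Wigner fermions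
at its endpoints, on one auxiliary qubit per vertex. The signs on the two factors cancel, so the
dressed edges are commuting involutions (`dressedEdge_commute`, `dressedEdge_mul_self`). Along a
closed walk the fermions telescope to `1` (`walkOp_kronecker`), so every stabilizer element,
tensored with `1`, is a product of dressed edges and the group is abelian. If such an element were
`-1`, independence of the labels would force every edge to occur an even number of times, and the
product would be `1`.

Distance (`eq_zero_or_closed_walk`): commuting with all closed walks makes `w = comb v x` a product
of vertex operators and edge operators, `x i p = t i + D (edge)`. If the weight is at most two, `w`
lives at a set `T` of at most two vertices, and 3-connectedness makes `t` constant off `T`, where it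
can be normalised to `0`. Then edges with `D = 1` join the two vertices of `T`, so there are at most
two of them, and the weight conditions leave only the identity and the closed walk formed by two
parallel edges.

Explicit modes: "`a` carries a `Z` of the modes at `b`" is a tournament on the qubits, which gives
anticommutation. The vertex operator is `Z` on every qubit of the vertex, since both anticommute
with every mode there, and the weights are then read off. -/

instance : Fintype Pauli := ⟨{.I, .X, .Y, .Z}, fun x => by cases x <;> decide⟩

instance : Zero Pauli := ⟨.I⟩

/-- The label of the product of two Pauli matrices. -/
protected def add : Pauli → Pauli → Pauli
  | .I, b => b
  | a, .I => a
  | .X, .X => .I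
  | .X, .Y => .Z
  | .X, .Z => .Y
  | .Y, .X => .Z
  | .Y, .Y => .I
  | .Y, .Z => .X
  | .Z, .X => .Y
  | .Z, .Y => .X
  | .Z, .Z => .I

instance : Add Pauli := ⟨Pauli.add⟩

instance : Neg Pauli := ⟨id⟩

instance : AddCommGroup Pauli where
  add_assoc := by decide
  zero_add := by decide
  add_zero := by decide
  add_comm := by decide
  neg_add_cancel := by decide
  nsmul := nsmulRec
  zsmul := zsmulRec

instance : Module (ZMod 2) Pauli :=
  AddCommGroup.zmodModule fun x => by rw [two_nsmul]; revert x; decide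

theorem card_eq : Fintype.card Pauli = 4 := rfl

theorem add_self (a : Pauli) : a + a = 0 := by revert a; decide

/-- `0` if the Pauli matrices commute, `1` if they anticommute. -/
def form (a b : Pauli) : ZMod 2 := if a = 0 ∨ b = 0 ∨ a = b then 0 else 1

theorem form_add_left : ∀ a b c : Pauli, form (a + b) c = form a c + form b c := by decide

theorem form_add_right : ∀ a b c : Pauli, form a (b + c) = form a b + form a c := by decide

theorem form_smul_left (z : ZMod 2) (a b : Pauli) : form (z • a) b = z • form a b := by
  fin_cases z
  · change form ((0 : ZMod 2) • a) b = (0 : ZMod 2) • _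
    rw [zero_smul, zero_smul]; revert a b; decide
  · change form ((1 : ZMod 2) • a) b = (1 : ZMod 2) • _
    rw [one_smul, one_smul]

theorem form_comm : ∀ a b : Pauli, form a b = form b a := by decide

theorem form_smul_right (z : ZMod 2) (a b : Pauli) : form a (z • b) = z • form a b := by
  rw [form_comm, form_smul_left, form_comm]

/-- The sign `(-1) ^ z`. -/
def sign (z : ZMod 2) : ℂ := if z = 0 then 1 else -1

/-- The phase in the product of two Pauli matrices. -/
noncomputable def phase : Pauli → Pauli → ℂ
  | .X, .Y => Complex.I
  | .Y, .X => -Complex.I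
  | .Y, .Z => Complex.I
  | .Z, .Y => -Complex.I
  | .Z, .X => Complex.I
  | .X, .Z => -Complex.I
  | _, _ => 1

theorem phase_pow (a b : Pauli) : phase a b ^ 4 = 1 := by
  cases a <;> cases b <;> simp [phase, Even.neg_pow (by decide : Even 4)]

theorem mat_mul (a b : Pauli) : a.mat * b.mat = phase a b • (a + b).mat := by
  change _ = phase a b • (Pauli.add a b).mat
  cases a <;> cases b <;> ext i j <;> fin_cases i <;> fin_cases j <;>
    simp [mat, phase, Pauli.add, Matrix.mul_apply, Fin.sum_univ_two]

theorem phase_swap (a b : Pauli) : phase a b = sign (form a b) * phase b a := by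
  cases a <;> cases b <;> simp [phase, sign, form, (by decide : (0 : Pauli) = .I)]

theorem phase_self (a : Pauli) : phase a a = 1 := by cases a <;> rfl

end Pauli

theorem zmod_two_cases : ∀ z : ZMod 2, z = 0 ∨ z = 1 := by decide

open Pauli in
theorem sign_add (x y : ZMod 2) : sign (x + y) = sign x * sign y := by
  rcases zmod_two_cases x with rfl | rfl <;> rcases zmod_two_cases y with rfl | rfl <;>
    simp [sign, (by decide : (1 : ZMod 2) + 1 = 0)]

open Pauli in
theorem sign_sum {ι : Type*} (s : Finset ι) (f : ι → ZMod 2) :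
    sign (∑ i ∈ s, f i) = ∏ i ∈ s, sign (f i) := by
  classical
  induction s using Finset.induction_on with
  | empty => simp [sign]
  | insert a s ha ih => rw [Finset.sum_insert ha, Finset.prod_insert ha, sign_add, ih]

section

variable {Q : Type*} [Fintype Q]

/-- The symplectic form on labels of Pauli operators, which governs their commutation. -/
def symp : (Q → Pauli) →ₗ[ZMod 2] (Q → Pauli) →ₗ[ZMod 2] ZMod 2 :=
  LinearMap.mk₂ (ZMod 2) (fun v w => ∑ q, (v q).form (w q))
    (fun v v' w => by simp [Pauli.form_add_left, Finset.sum_add_distrib])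
    (fun c v w => by simp only [Pi.smul_apply, Pauli.form_smul_left, Finset.smul_sum])
    (fun v w w' => by simp [Pauli.form_add_right, Finset.sum_add_distrib])
    (fun c v w => by simp only [Pi.smul_apply, Pauli.form_smul_right, Finset.smul_sum])

theorem symp_apply (v w : Q → Pauli) : symp v w = ∑ q, (v q).form (w q) := rfl

theorem symp_self (v : Q → Pauli) : symp v v = 0 := by simp [symp_apply, Pauli.form]

theorem vec_add_self (v : Q → Pauli) : v + v = 0 := funext fun q => (v q).add_self

theorem symp_eq_zero_of_disjoint {v w : Q → Pauli} (h : ∀ q, v q = 0 ∨ w q = 0) :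
    symp v w = 0 :=
  Finset.sum_eq_zero fun q _ => by rcases h q with h | h <;> simp [Pauli.form, h]

theorem op_eq_zero_of_add_self {R : Type*} {A : Matrix R R ℂ} (h : A + A = 0) : A = 0 := by
  rw [← two_smul ℂ, smul_eq_zero] at h
  exact h.resolve_left two_ne_zero

/-- The number of qubits on which a label is non-trivial. -/
noncomputable def wt (v : Q → Pauli) : ℕ := {q | v q ≠ 0}.ncard

/-! ### Products of Pauli operators -/

theorem pauliOp_mul_apply [DecidableEq Q] (v w : Q → Pauli) :
    pauliOp v * pauliOp w = (∏ q, (v q).phase (w q)) • pauliOp (v + w) := by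
  ext a b
  simp only [Matrix.mul_apply, pauliOp, Matrix.of_apply, Matrix.smul_apply, smul_eq_mul,
    ← Finset.prod_mul_distrib]
  -- The sum over intermediate basis states of a product over qubits factors into one `2 × 2` matrix
  -- product per qubit.
  have := Finset.prod_univ_sum (fun _ : Q => (Finset.univ : Finset (Fin 2)))
    (fun q c => (v q).mat (a q) c * (w q).mat c (b q))
  rw [Fintype.piFinset_univ] at this
  rw [← this]
  refine Finset.prod_congr rfl fun q _ => ?_
  rw [← Matrix.mul_apply, Pauli.mat_mul]
  rfl

theorem pauliOp_zero [DecidableEq Q] : pauliOp (0 : Q → Pauli) = 1 := by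
  ext a b
  have h : ∀ x y : Fin 2, (0 : Pauli).mat x y = if x = y then 1 else 0 := by
    intro x y
    change Pauli.I.mat x y = _
    fin_cases x <;> fin_cases y <;> simp [Pauli.mat]
  simp only [pauliOp, Matrix.of_apply, Pi.zero_apply, h, Matrix.one_apply, Finset.prod_ite_zero,
    Finset.prod_const_one, funext_iff, Finset.mem_univ, true_imp_iff]

theorem pauliOp_mul_self [DecidableEq Q] (v : Q → Pauli) : pauliOp v * pauliOp v = 1 := by
  rw [pauliOp_mul_apply, vec_add_self, pauliOp_zero]
  simp [Pauli.phase_self]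

theorem pauliOp_isHermitian (v : Q → Pauli) : (pauliOp v).IsHermitian := by
  ext a b
  have h : ∀ (p : Pauli) (x y : Fin 2), star (p.mat y x) = p.mat x y := by
    intro p x y
    cases p <;> fin_cases x <;> fin_cases y <;> simp [Pauli.mat]
  simp [pauliOp, Matrix.conjTranspose_apply, h]

/-- `O` is a Pauli operator with label `v`. -/
def HasLabel (O : Op Q) (v : Q → Pauli) : Prop := ∃ c : ℂ, c ^ 4 = 1 ∧ O = c • pauliOp v

theorem hasLabel_pauliOp (v : Q → Pauli) : HasLabel (pauliOp v) v := ⟨1, by simp, by simp⟩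

theorem isPauli_iff {O : Op Q} : IsPauli O ↔ ∃ v, HasLabel O v := exists_comm

namespace HasLabel

theorem isPauli {O : Op Q} {v : Q → Pauli} (h : HasLabel O v) : IsPauli O := isPauli_iff.2 ⟨v, h⟩

theorem smul {O : Op Q} {v : Q → Pauli} (h : HasLabel O v) {c : ℂ} (hc : c ^ 4 = 1) :
    HasLabel (c • O) v := by
  obtain ⟨c', hc', rfl⟩ := h
  exact ⟨c * c', by rw [mul_pow, hc, hc', one_mul], smul_smul _ _ _⟩

variable [DecidableEq Q]

theorem one : HasLabel (1 : Op Q) 0 := pauliOp_zero (Q := Q) ▸ hasLabel_pauliOp _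

theorem mul {A B : Op Q} {v w : Q → Pauli} (hA : HasLabel A v) (hB : HasLabel B w) :
    HasLabel (A * B) (v + w) := by
  obtain ⟨c, hc, rfl⟩ := hA
  obtain ⟨d, hd, rfl⟩ := hB
  refine ⟨c * d * ∏ q, (v q).phase (w q), ?_, ?_⟩
  · rw [mul_pow, mul_pow, hc, hd, ← Finset.prod_pow]
    simp [Pauli.phase_pow]
  · rw [Matrix.smul_mul, Matrix.mul_smul, pauliOp_mul_apply, smul_smul, smul_smul]

theorem list_prod {ι : Type*} {A : ι → Op Q} {v : ι → Q → Pauli} (h : ∀ i, HasLabel (A i) (v i))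
    (l : List ι) : HasLabel (l.map A).prod (l.map v).sum := by
  induction l with
  | nil => exact one
  | cons a l ih => simpa using (h a).mul ih

/-- Swapping the factors changes the phase on each qubit by the sign of `Pauli.form`; the signs
multiply to that of the sum. -/
theorem comm {A B : Op Q} {v w : Q → Pauli} (hA : HasLabel A v) (hB : HasLabel B w) :
    A * B = Pauli.sign (symp v w) • (B * A) := by
  obtain ⟨c, hc, rfl⟩ := hA
  obtain ⟨d, hd, rfl⟩ := hB
  have : ∏ q, (v q).phase (w q) = Pauli.sign (symp v w) * ∏ q, (w q).phase (v q) := by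
    rw [symp_apply, sign_sum, ← Finset.prod_mul_distrib]
    exact Finset.prod_congr rfl fun q _ => Pauli.phase_swap _ _
  simp only [Matrix.smul_mul, Matrix.mul_smul, pauliOp_mul_apply, smul_smul, this, add_comm w v]
  congr 1
  ring

theorem exists_inv {A : Op Q} {v : Q → Pauli} (hA : HasLabel A v) :
    ∃ B, HasLabel B v ∧ A * B = 1 ∧ B * A = 1 := by
  obtain ⟨c, hc, rfl⟩ := hA
  have h0 : c ≠ 0 := by rintro rfl; simp at hc
  refine ⟨c⁻¹ • pauliOp v, ⟨c⁻¹, by rw [inv_pow, hc, inv_one], rfl⟩, ?_, ?_⟩ <;>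
    simp [smul_smul, pauliOp_mul_self, h0]

theorem ne_zero {A : Op Q} {v : Q → Pauli} (hA : HasLabel A v) : A ≠ 0 := by
  rintro rfl
  obtain ⟨B, -, h, -⟩ := hA.exists_inv
  rw [Matrix.zero_mul] at h
  exact zero_ne_one h

theorem symp_eq_zero {A B : Op Q} {v w : Q → Pauli} (hA : HasLabel A v) (hB : HasLabel B w)
    (h : A * B = B * A) : symp v w = 0 := by
  by_contra h0
  have h1 := hA.comm hB
  rw [Pauli.sign, if_neg h0, h, neg_smul, one_smul, eq_neg_iff_add_eq_zero] at h1
  exact (hB.mul hA).ne_zero (op_eq_zero_of_add_self h1)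

theorem symp_eq_one {A B : Op Q} {v w : Q → Pauli} (hA : HasLabel A v) (hB : HasLabel B w)
    (h : A * B + B * A = 0) : symp v w = 1 := by
  by_contra h0
  have h0 := (zmod_two_cases (symp v w)).resolve_right h0
  have h1 := hA.comm hB
  rw [h0, Pauli.sign, if_pos rfl, one_smul] at h1
  rw [h1] at h
  exact (hB.mul hA).ne_zero (op_eq_zero_of_add_self h)

theorem eq_smul {A B : Op Q} {v : Q → Pauli} (hA : HasLabel A v) (hB : HasLabel B v) :
    ∃ c : ℂ, c ^ 4 = 1 ∧ A = c • B := by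
  obtain ⟨c, hc, rfl⟩ := hA
  obtain ⟨d, hd, rfl⟩ := hB
  have h0 : d ≠ 0 := by rintro rfl; simp at hd
  exact ⟨c * d⁻¹, by rw [mul_pow, inv_pow, hc, hd]; simp, by simp [smul_smul, h0]⟩

/-- The label is determined by the operator. -/
theorem unique {A : Op Q} {v w : Q → Pauli} (hv : HasLabel A v) (hw : HasLabel A w) : v = w := by
  -- Commutation with every Pauli operator is a property of `A` alone, and a label is recovered from
  -- its symplectic products with single-qubit labels.
  have h : ∀ u, symp v u = symp w u := by
    intro u
    have h1 := hv.comm (hasLabel_pauliOp u)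
    rw [hw.comm (hasLabel_pauliOp u)] at h1
    by_contra hne
    have h2 := ((hasLabel_pauliOp u).mul hv).ne_zero
    have : Pauli.sign (symp w u) = Pauli.sign (symp v u) := smul_left_injective ℂ h2 h1
    revert hne this
    rcases zmod_two_cases (symp v u) with h | h <;> rcases zmod_two_cases (symp w u) with h' | h' <;>
      rw [h, h'] <;> norm_num [Pauli.sign]
  funext q
  have key : ∀ a : Pauli, symp v (Pi.single q a) = (v q).form a ∧
      symp w (Pi.single q a) = (w q).form a := by
    intro a
    constructor <;> rw [symp_apply, Finset.sum_eq_single q] <;> simp +contextual [Pauli.form]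
  have h' : ∀ a : Pauli, (v q).form a = (w q).form a := fun a => by
    rw [← (key a).1, h, (key a).2]
  revert h'
  generalize v q = x
  generalize w q = y
  revert x y
  decide

end HasLabel

end

/-! ### The weight of a Pauli operator -/

section

variable {Q : Type*} [Fintype Q] [DecidableEq Q]

theorem pauliOp_apply_split (v : Q → Pauli) (q : Q) (a b : Q → Fin 2) :
    pauliOp v a b = (v q).mat (a q) (b q) *
      pauliOp (fun r : {r : Q // r ≠ q} => v r) (fun r => a r) (fun r => b r) := by
  simp only [pauliOp, Matrix.of_apply]
  rw [Fintype.prod_eq_mul_prod_subtype_ne _ q]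

theorem HasLabel.actsTrivially_iff {O : Op Q} {v : Q → Pauli} (h : HasLabel O v) (q : Q) :
    ActsTrivially O q ↔ v q = 0 := by
  obtain ⟨c, hc, rfl⟩ := h
  have hc0 : c ≠ 0 := by rintro rfl; simp at hc
  constructor
  · rintro ⟨O', hO⟩
    -- Fixing a non-zero entry of the remaining tensor factor isolates the matrix on `q`: its
    -- off-diagonal entry excludes `X` and `Y`, and comparing its diagonal entries excludes `Z`.
    obtain ⟨a, b, hab⟩ : ∃ a b, pauliOp (fun r : {r : Q // r ≠ q} => v r) a b ≠ 0 := by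
      by_contra! h
      exact (hasLabel_pauliOp (fun r : {r : Q // r ≠ q} => v r)).ne_zero (by ext a b; exact h a b)
    let ext' : ({r : Q // r ≠ q} → Fin 2) → Fin 2 → Q → Fin 2 :=
      fun a x r => if h : r = q then x else a ⟨r, h⟩
    have e1 : ∀ a x, ext' a x q = x := fun a x => by simp [ext']
    have e2 : ∀ a x, (fun r : {r : Q // r ≠ q} => ext' a x r) = a := fun a x => by
      funext r; simp [ext', r.2]
    have key : ∀ x y, c * ((v q).mat x y * pauliOp (fun r : {r : Q // r ≠ q} => v r) a b) =
        if x = y then O' a b else 0 := by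
      intro x y
      have := hO (ext' a x) (ext' b y)
      rw [e1, e1, e2, e2, Matrix.smul_apply, pauliOp_apply_split v q, e1, e1, e2, e2] at this
      exact this
    have h01 := key 0 1
    have h00 := key 0 0
    have h11 := key 1 1
    change v q = Pauli.I
    revert h01 h00 h11
    cases v q <;> simp [Pauli.mat, hc0, hab]
    intro h1 h2
    rw [← h1, neg_eq_self] at h2
    simp [hc0, hab] at h2
  · intro h
    refine ⟨c • pauliOp (fun r : {r : Q // r ≠ q} => v r), fun a b => ?_⟩
    rw [Matrix.smul_apply, pauliOp_apply_split v q, h]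
    change c • (Pauli.I.mat _ _ * _) = _
    generalize a q = x
    generalize b q = y
    fin_cases x <;> fin_cases y <;> simp [Pauli.mat]

theorem HasLabel.weight_eq {O : Op Q} {v : Q → Pauli} (h : HasLabel O v) : weight O = wt v := by
  simp only [weight, wt, h.actsTrivially_iff, ne_eq]

end

namespace Multigraph

variable {V E : Type*} {G : Multigraph V E}

/-! ### Labels of local Majorana modes -/

variable (G) in
/-- A choice of one Pauli label for every vertex and every label at this vertex. -/
abbrev ModeLabels := (i : V) → Fin (G.degree i) → G.Qubit → Pauli

variable [Fintype V] [DecidableEq V]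

/-- The labels of local Majorana modes: supported at their vertex, and pairwise anticommuting. -/
structure IsModeLabels (v : G.ModeLabels) : Prop where
  eq_zero : ∀ i p q, q.1 ≠ i → v i p q = 0
  symp_eq_one : ∀ i p q, p ≠ q → symp (v i p) (v i q) = 1

theorem IsLocalMajorana.exists_labels {γ : G.Modes} (h : G.IsLocalMajorana γ) :
    ∃ v : G.ModeLabels, IsModeLabels v ∧ ∀ i p, HasLabel (γ i p) (v i p) := by
  choose c v hc hs hv using h.isPauliOn
  have hl : ∀ i p, HasLabel (γ i p) (v i p) := fun i p => ⟨c i p, hc i p, hv i p⟩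
  refine ⟨v, ⟨fun i p q hq => hs i p q hq, fun i p q hpq => ?_⟩, hl⟩
  refine (hl i p).symp_eq_one (hl i q) ?_
  rw [h.anticomm, if_neg hpq]

theorem IsLocalMajorana.mul_self {γ : G.Modes} (h : G.IsLocalMajorana γ) (i : V)
    (p : Fin (G.degree i)) : γ i p * γ i p = 1 := by
  have := h.anticomm i p p
  rw [if_pos rfl, two_nsmul, ← two_smul ℂ, ← two_smul ℂ (1 : Op G.Qubit)] at this
  exact smul_right_injective _ (two_ne_zero (α := ℂ)) this

/-- The label of a product of modes at the vertex `i`. -/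
noncomputable def localComb (v : G.ModeLabels) (i : V) (x : Fin (G.degree i) → ZMod 2) : G.Qubit → Pauli :=
  ∑ p, x p • v i p

/-- The label of a product of modes. -/
noncomputable def comb (v : G.ModeLabels) (x : (i : V) → Fin (G.degree i) → ZMod 2) : G.Qubit → Pauli :=
  ∑ i, localComb v i (x i)

theorem localComb_sub (v : G.ModeLabels) (i : V) (x y : Fin (G.degree i) → ZMod 2) :
    localComb v i (x - y) = localComb v i x - localComb v i y := by
  simp [localComb, sub_smul]

theorem localComb_add (v : G.ModeLabels) (i : V) (x y : Fin (G.degree i) → ZMod 2) :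
    localComb v i (x + y) = localComb v i x + localComb v i y := by
  simp [localComb, add_smul, Finset.sum_add_distrib]

theorem localComb_zero (v : G.ModeLabels) (i : V) : localComb v i 0 = 0 := by simp [localComb]

theorem localComb_single (v : G.ModeLabels) (i : V) (p : Fin (G.degree i)) :
    localComb v i (Pi.single p 1) = v i p := by
  rw [localComb, Finset.sum_eq_single p] <;> simp +contextual

theorem comb_add (v : G.ModeLabels) (x y : (i : V) → Fin (G.degree i) → ZMod 2) :
    comb v (x + y) = comb v x + comb v y := by
  simp [comb, localComb_add, Finset.sum_add_distrib]

theorem comb_zero (v : G.ModeLabels) : comb v 0 = 0 := by simp [comb, localComb_zero]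

namespace IsModeLabels

variable {v : G.ModeLabels} (hv : IsModeLabels v)

include hv

theorem symp_of_ne {i j : V} (hij : i ≠ j) (p : Fin (G.degree i)) (q : Fin (G.degree j)) :
    symp (v i p) (v j q) = 0 := by
  refine symp_eq_zero_of_disjoint fun r => ?_
  by_cases h : r.1 = i
  · exact Or.inr (hv.eq_zero _ _ _ (h ▸ hij))
  · exact Or.inl (hv.eq_zero _ _ _ h)

theorem symp_same (i : V) (p q : Fin (G.degree i)) :
    symp (v i p) (v i q) = 1 + if p = q then 1 else 0 := by
  split_ifs with h
  · rw [h, symp_self]; rfl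
  · rw [hv.symp_eq_one i p q h, add_zero]

theorem symp_localComb_same (i : V) (x : Fin (G.degree i) → ZMod 2) (q : Fin (G.degree i)) :
    symp (localComb v i x) (v i q) = (∑ p, x p) + x q := by
  simp [localComb, hv.symp_same, mul_add, Finset.sum_add_distrib]

theorem symp_localComb_of_ne {i j : V} (hij : i ≠ j) (x : Fin (G.degree i) → ZMod 2)
    (q : Fin (G.degree j)) : symp (localComb v i x) (v j q) = 0 := by
  simp [localComb, hv.symp_of_ne hij]

theorem symp_comb (x : (i : V) → Fin (G.degree i) → ZMod 2) (j : V) (q : Fin (G.degree j)) :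
    symp (comb v x) (v j q) = (∑ p, x j p) + x j q := by
  rw [comb, map_sum, LinearMap.sum_apply, Finset.sum_eq_single j, hv.symp_localComb_same]
  · exact fun i _ hij => hv.symp_localComb_of_ne hij _ _
  · simp

theorem localComb_apply_of_ne {i : V} (x : Fin (G.degree i) → ZMod 2) {q : G.Qubit}
    (hq : q.1 ≠ i) : localComb v i x q = 0 := by
  simp [localComb, hv.eq_zero _ _ _ hq]

theorem comb_apply (x : (i : V) → Fin (G.degree i) → ZMod 2) (q : G.Qubit) :
    comb v x q = localComb v q.1 (x q.1) q := by
  rw [comb, Finset.sum_apply, Finset.sum_eq_single q.1]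
  · exact fun i _ hi => hv.localComb_apply_of_ne _ (Ne.symm hi)
  · simp

end IsModeLabels

/-- This is injectivity of `J + 1` over `ZMod 2` in even dimension: all coordinates equal their
total, and the total of an even number of equal bits is `0`. -/
theorem eq_zero_of_sum_add {d : ℕ} (hd : Even d) {x : Fin d → ZMod 2}
    (h : ∀ q, (∑ p, x p) + x q = 0) : x = 0 := by
  have h2 : (2 : ZMod 2) = 0 := rfl
  have h1 : ∀ q, x q = ∑ p, x p := fun q => by
    exact (CharTwo.add_eq_zero.1 (h q)).symm
  have hs : ∑ p, x p = 0 := by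
    obtain ⟨k, rfl⟩ := hd
    rw [Finset.sum_congr rfl fun q _ => h1 q, Finset.sum_const, Finset.card_univ, Fintype.card_fin,
      nsmul_eq_mul, Nat.cast_add, ← two_mul, h2, zero_mul, zero_mul]
  funext q
  rw [h1, hs, Pi.zero_apply]

namespace IsModeLabels

variable {v : G.ModeLabels} (hv : IsModeLabels v) (heven : ∀ i, Even (G.degree i))

include hv heven

theorem localComb_injective (i : V) : Function.Injective (localComb v i) := by
  intro x y hxy
  rw [← sub_eq_zero, ← localComb_sub] at hxy
  rw [← sub_eq_zero]
  refine eq_zero_of_sum_add (heven i) fun q => ?_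
  rw [← hv.symp_localComb_same, hxy, map_zero, LinearMap.zero_apply]

theorem comb_injective : Function.Injective (comb v) := by
  intro x y hxy
  funext i
  refine hv.localComb_injective heven i (funext fun q => ?_)
  by_cases hq : q.1 = i
  · subst hq
    rw [← hv.comb_apply, ← hv.comb_apply, hxy]
  · rw [hv.localComb_apply_of_ne _ hq, hv.localComb_apply_of_ne _ hq]

/-- An injective map between sets of equal size: `2 ^ d` bit strings against `4 ^ (d / 2)` labels at
each vertex. -/
theorem comb_surjective : Function.Surjective (comb v) := by
  refine ((Fintype.bijective_iff_injective_and_card _).2 ⟨hv.comb_injective heven, ?_⟩).2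
  rw [Fintype.card_pi, Fintype.card_fun, Fintype.card_sigma, Pauli.card_eq, ← Finset.prod_pow_eq_pow_sum]
  refine Finset.prod_congr rfl fun i _ => ?_
  rw [Fintype.card_fun, Fintype.card_fin, Fintype.card_fin, ZMod.card, (by norm_num : 4 = 2 ^ 2),
    ← pow_mul, Nat.two_mul_div_two_of_even (heven i)]

theorem eq_zero_of_symp {w : G.Qubit → Pauli} (h : ∀ i p, symp w (v i p) = 0) : w = 0 := by
  obtain ⟨x, rfl⟩ := hv.comb_surjective heven w
  have : x = 0 := funext fun i => eq_zero_of_sum_add (heven i) fun q => by rw [← hv.symp_comb, h]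
  subst this
  exact comb_zero v

end IsModeLabels

/-- Pairwise anticommuting Pauli operators in the right number generate the Pauli operators at a
vertex. -/
theorem IsModeLabels.exists_mem_closure {v : G.ModeLabels} (hv : IsModeLabels v)
    (heven : ∀ i, Even (G.degree i)) {γ : G.Modes} (hγ : ∀ i p, HasLabel (γ i p) (v i p)) (i : V)
    {O : Op G.Qubit} (hO : IsPauliOn {q : G.Qubit | q.1 = i} O) :
    ∃ (c : ℂ) (M : Op G.Qubit),
      c ^ 4 = 1 ∧ M ∈ Submonoid.closure (Set.range (γ i)) ∧ O = c • M := by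
  obtain ⟨c, w, hc, hw, hOw⟩ := hO
  obtain ⟨x, rfl⟩ := hv.comb_surjective heven w
  have hx : comb v x = localComb v i (x i) := by
    funext q
    by_cases hq : q.1 = i
    · subst hq
      exact hv.comb_apply _ _
    · rw [hv.localComb_apply_of_ne _ hq]
      exact hw q hq
  -- The order of the factors only affects the phase, so the product can be built one mode at a
  -- time.
  have hM : ∀ s : Finset (Fin (G.degree i)), ∃ M ∈ Submonoid.closure (Set.range (γ i)),
      HasLabel M (∑ p ∈ s, x i p • v i p) := by
    intro s
    induction s using Finset.induction_on with
    | empty => exact ⟨1, one_mem _, HasLabel.one⟩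
    | insert a s ha ih =>
      obtain ⟨M, hM, hl⟩ := ih
      rw [Finset.sum_insert ha]
      rcases zmod_two_cases (x i a) with h | h
      · exact ⟨M, hM, by rwa [h, zero_smul, zero_add]⟩
      · refine ⟨γ i a * M, mul_mem (Submonoid.subset_closure ⟨a, rfl⟩) hM, ?_⟩
        rw [h, one_smul]
        exact (hγ i a).mul hl
  obtain ⟨M, hM, hl⟩ := hM Finset.univ
  have hO' : HasLabel O (localComb v i (x i)) := ⟨c, hc, by rw [hOw, hx]⟩
  obtain ⟨c', hc', h⟩ := hO'.eq_smul hl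
  exact ⟨c', M, hc', hM, h⟩

theorem hasLabel_vertexOp {γ : G.Modes} {v : G.ModeLabels}
    (hγ : ∀ i p, HasLabel (γ i p) (v i p)) (i : V) :
    HasLabel (vertexOp γ i) (localComb v i 1) := by
  have h : localComb v i 1 = (List.ofFn (v i)).sum := by simp [localComb, List.sum_ofFn]
  rw [h, List.ofFn_eq_map, vertexOp, List.ofFn_eq_map]
  refine (HasLabel.list_prod (hγ i) _).smul ?_
  rw [pow_right_comm, Even.neg_pow (by decide), Complex.I_pow_four, one_pow]

end Multigraph

/-! ### Majorana modes on a line of qubits -/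

/-- The label of the Jordan-Wigner Majorana mode at `j`. -/
noncomputable def jordanWigner {V : Type*} [Fintype V] [DecidableEq V] (j k : V) : Pauli :=
  if k = j then .X else if Fintype.equivFin V k < Fintype.equivFin V j then .Z else .I

/-- Away from `i` and `j` both labels are `Z` or `I`. At these two positions `X` meets one `Z` and
one `I`, according to the order of `i` and `j`. -/
theorem symp_jordanWigner {V : Type*} [Fintype V] [DecidableEq V] (i j : V) :
    symp (jordanWigner i) (jordanWigner j) = 1 + if i = j then 1 else 0 := by
  split_ifs with h
  · rw [h, symp_self]; rfl
  rw [symp_apply, add_zero, Fintype.sum_eq_add i j h]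
  · have h' : Fintype.equivFin V i ≠ Fintype.equivFin V j := fun e => h ((Equiv.injective _) e)
    rcases lt_or_gt_of_ne h' with h' | h' <;>
      simp [jordanWigner, Ne.symm h, h', h, not_lt_of_gt h'] <;> decide
  · rintro k ⟨hi, hj⟩
    simp only [jordanWigner, if_neg hi, if_neg hj]
    split_ifs <;> decide

/-- The head has a second occurrence; commutativity brings the two together and they cancel. -/
theorem prod_map_eq_one_of_even_count {ι M : Type*} [DecidableEq ι] [Monoid M] (T : ι → M)
    (hcomm : ∀ i j, Commute (T i) (T j)) (hsq : ∀ i, T i * T i = 1) (l : List ι)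
    (h : ∀ i, Even (l.count i)) : (l.map T).prod = 1 := by
  induction hn : l.length using Nat.strong_induction_on generalizing l with
  | _ n ih =>
    cases l with
    | nil => rfl
    | cons a l =>
      have ha : a ∈ l := by
        by_contra ha
        have := h a
        rw [List.count_cons_self, List.count_eq_zero_of_not_mem ha] at this
        exact absurd this (by decide)
      have hp := List.perm_cons_erase ha
      have hprod : (l.map T).prod = ((a :: l.erase a).map T).prod :=
        (hp.map T).prod_eq' (List.pairwise_map.2 (List.pairwise_of_forall fun x y => hcomm x y))
      rw [List.map_cons, List.prod_cons, hprod, List.map_cons, List.prod_cons, ← mul_assoc, hsq,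
        one_mul]
      refine ih (l.erase a).length ?_ _ (fun i => ?_) rfl
      · rw [← hn, List.length_cons, hp.length_eq, List.length_cons]
        omega
      · have := h i
        rw [(hp.cons a).count_eq, List.count_cons, List.count_cons] at this
        by_cases hi : a = i
        · simpa [hi, Nat.even_add_one] using this
        · simpa [hi] using this

/-! ### Labels of edge and walk operators -/

namespace Multigraph

variable {V E : Type*} {G : Multigraph V E}

/-- The edges of a walk, in order. -/
def Walk.edges : {u v : V} → G.Walk u v → List E
  | _, _, .nil _ => []
  | _, _, .cons e _ p => e :: p.edges

theorem joins_tail_head (e : E) : G.Joins e (G.tail e) (G.head e) := Or.inl ⟨rfl, rfl⟩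

theorem Labelling.label_inj (L : G.Labelling) {i : V} {e f : E} (he : G.Inc e i) (hf : G.Inc f i) :
    L.label i e he = L.label i f hf ↔ e = f := by
  simp [Labelling.label]

/-- The label of the edge operator. -/
noncomputable def edgeLabel (L : G.Labelling) (v : G.ModeLabels) (e : E) : G.Qubit → Pauli :=
  v (G.tail e) (L.label _ e (joins_tail_head e).inc_left) +
    v (G.head e) (L.label _ e (joins_tail_head e).inc_right)

theorem edgeLabel_eq (L : G.Labelling) (v : G.ModeLabels) {e : E} {j k : V} (h : G.Joins e j k) :
    edgeLabel L v e = v j (L.label j e h.inc_left) + v k (L.label k e h.inc_right) := by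
  have h' := h
  obtain ⟨rfl, rfl⟩ | ⟨rfl, rfl⟩ := h'
  · rfl
  · exact add_comm _ _

theorem joins_ne {e : E} {j k : V} (h : G.Joins e j k) : j ≠ k := by
  obtain ⟨rfl, rfl⟩ | ⟨rfl, rfl⟩ := h
  · exact G.tail_ne_head e
  · exact (G.tail_ne_head e).symm

variable [Fintype V] [DecidableEq V]

section

variable {γ : G.Modes} {v : G.ModeLabels} (hγ : ∀ i p, HasLabel (γ i p) (v i p)) (L : G.Labelling)

include hγ

theorem hasLabel_edgeOp {e : E} {j k : V} (h : G.Joins e j k) :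
    HasLabel (edgeOp L γ e h) (edgeLabel L v e) := by
  rw [edgeLabel_eq L v h, edgeOp]
  refine ((hγ _ _).mul (hγ _ _)).smul ?_
  split_ifs <;> norm_num

theorem hasLabel_I_smul_edgeOp {e : E} {j k : V} (h : G.Joins e j k) :
    HasLabel (Complex.I • edgeOp L γ e h) (edgeLabel L v e) :=
  (hasLabel_edgeOp hγ L h).smul Complex.I_pow_four

theorem hasLabel_walkOp : ∀ {i j : V} (ζ : G.Walk i j),
    HasLabel (walkOp L γ ζ) (ζ.edges.map (edgeLabel L v)).sum
  | _, _, .nil _ => HasLabel.one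
  | _, _, .cons _ h p => (hasLabel_I_smul_edgeOp hγ L h).mul (hasLabel_walkOp p)

end

/-! ### Comparison of the edge operators with fermionic hopping operators -/

/-- The Jordan-Wigner Majorana operator at `j`. -/
noncomputable def fermion (j : V) : Op V := pauliOp (jordanWigner j)

theorem fermion_mul_self (j : V) : fermion j * fermion j = 1 := pauliOp_mul_self _

theorem fermion_swap {j k : V} (h : j ≠ k) : fermion j * fermion k = -(fermion k * fermion j) := by
  rw [fermion, fermion, (hasLabel_pauliOp _).comm (hasLabel_pauliOp _), symp_jordanWigner, if_neg h]
  simp [Pauli.sign]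

open scoped Kronecker in
/-- The edge operator, tensored with the corresponding product of fermionic Majorana modes on
auxiliary qubits. -/
noncomputable def dressedEdge (L : G.Labelling) (γ : G.Modes) (e : E) :
    Matrix ((G.Qubit → Fin 2) × (V → Fin 2)) ((G.Qubit → Fin 2) × (V → Fin 2)) ℂ :=
  (Complex.I • edgeOp L γ e (joins_tail_head e)) ⊗ₖ (fermion (G.tail e) * fermion (G.head e))

section

variable {γ : G.Modes} (h : G.IsLocalMajorana γ) (L : G.Labelling)

include h

theorem modes_comm {j k : V} (hjk : j ≠ k) (p : Fin (G.degree j)) (q : Fin (G.degree k)) :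
    γ j p * γ k q = γ k q * γ j p := by
  obtain ⟨v, hv, hl⟩ := h.exists_labels
  rw [(hl j p).comm (hl k q), hv.symp_of_ne hjk, Pauli.sign, if_pos rfl, one_smul]

/-- Modes at different vertices commute, so only the orientation sign changes. -/
theorem edgeOp_swap {e : E} {j k : V} (hj : G.Joins e j k) (hk : G.Joins e k j) :
    edgeOp L γ e hj = -edgeOp L γ e hk := by
  have hne := joins_ne hj
  rw [edgeOp, edgeOp, modes_comm h hne]
  obtain ⟨rfl, rfl⟩ | ⟨rfl, rfl⟩ := id hj
  · simp [hne.symm]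
  · simp [hne]

/-- The factor `i` turns the square `1` of an edge operator into `-1`, matching the square of a
product of two distinct fermions. -/
theorem I_smul_edgeOp_mul_self {e : E} {j k : V} (hj : G.Joins e j k) :
    (Complex.I • edgeOp L γ e hj) * (Complex.I • edgeOp L γ e hj) = -1 := by
  have h1 : ∀ a b : Op G.Qubit, a * a = 1 → b * b = 1 → a * b = b * a →
      (a * b) * (a * b) = 1 := by
    intro a b ha hb hab
    rw [mul_assoc, ← mul_assoc b, ← hab, mul_assoc, hb, mul_one, ha]
  have h2 := h1 _ _ (h.mul_self j (L.label j e hj.inc_left)) (h.mul_self k (L.label k e hj.inc_right))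
    (modes_comm h (joins_ne hj) _ _)
  have h3 : (if G.head e = j then (1 : ℂ) else -1) * (if G.head e = j then (1 : ℂ) else -1) = 1 := by
    split_ifs <;> norm_num
  rw [edgeOp, smul_mul_smul_comm, smul_mul_smul_comm, h2, h3, Complex.I_mul_I, one_smul, neg_smul,
    one_smul]

open scoped Kronecker

/-- Reversing the traversal flips the sign of both tensor factors, so the dressed edge does not
depend on the direction. -/
theorem kronecker_eq_dressedEdge {e : E} {j k : V} (hj : G.Joins e j k) :
    (Complex.I • edgeOp L γ e hj) ⊗ₖ (fermion j * fermion k) = dressedEdge L γ e := by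
  obtain ⟨rfl, rfl⟩ | ⟨rfl, rfl⟩ := id hj
  · rfl
  · rw [dressedEdge, edgeOp_swap h L hj (joins_tail_head e), fermion_swap (joins_ne hj), smul_neg,
      ← neg_one_smul ℂ, ← neg_one_smul ℂ (fermion (G.tail e) * fermion (G.head e)),
      Matrix.smul_kronecker, Matrix.kronecker_smul, smul_smul]
    norm_num

/-- The fermions at intermediate vertices square to `1` and telescope; only those at the two ends
survive. -/
theorem walkOp_kronecker : ∀ {i j : V} (ζ : G.Walk i j),
    walkOp L γ ζ ⊗ₖ (fermion i * fermion j) = (ζ.edges.map (dressedEdge L γ)).prod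
  | _, _, .nil i => by
    rw [fermion_mul_self, walkOp, Matrix.one_kronecker_one]
    rfl
  | i, j, .cons (v := k) e hj p => by
    have : fermion i * fermion j = (fermion i * fermion k) * (fermion k * fermion j) := by
      rw [mul_assoc, ← mul_assoc (fermion k), fermion_mul_self, one_mul]
    rw [this, walkOp, Matrix.mul_kronecker_mul, kronecker_eq_dressedEdge h, walkOp_kronecker p,
      Walk.edges, List.map_cons, List.prod_cons]

theorem dressedEdge_mul_self (e : E) : dressedEdge L γ e * dressedEdge L γ e = 1 := by
  have hne := G.tail_ne_head e
  have hf : (fermion (G.tail e) * fermion (G.head e)) * (fermion (G.tail e) * fermion (G.head e)) =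
      -1 := by
    rw [mul_assoc, ← mul_assoc (fermion (G.head e)), fermion_swap hne.symm, neg_mul, mul_assoc,
      fermion_mul_self, mul_neg, mul_one, fermion_mul_self]
  rw [dressedEdge, ← Matrix.mul_kronecker_mul, I_smul_edgeOp_mul_self h, hf, ← neg_one_smul ℂ,
    ← neg_one_smul ℂ (1 : Op V), Matrix.smul_kronecker, Matrix.kronecker_smul, smul_smul,
    Matrix.one_kronecker_one]
  norm_num

/-- For `e ≠ f`, the modes at an endpoint of each anticommute exactly when these endpoints coincide,
and the fermions exactly when they differ. The two symplectic products thus differ by `1` for each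
of the four pairs of endpoints, hence agree modulo `2`, and the two signs cancel. -/
theorem dressedEdge_commute (e f : E) : Commute (dressedEdge L γ e) (dressedEdge L γ f) := by
  classical
  by_cases hef : e = f
  · rw [hef]
  obtain ⟨v, hv, hl⟩ := h.exists_labels
  have hfl : ∀ e : E, HasLabel (fermion (G.tail e) * fermion (G.head e))
      (jordanWigner (G.tail e) + jordanWigner (G.head e)) :=
    fun e => (hasLabel_pauliOp _).mul (hasLabel_pauliOp _)
  have hs : ∀ (i j : V) (hi : G.Inc e i) (hj : G.Inc f j),
      symp (v i (L.label i e hi)) (v j (L.label j f hj)) = 1 + symp (jordanWigner i) (jordanWigner j) := by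
    intro i j hi hj
    rw [symp_jordanWigner]
    split_ifs with hij
    · subst hij
      rw [hv.symp_eq_one]
      · rfl
      · rwa [Ne, L.label_inj]
    · rw [hv.symp_of_ne hij]; rfl
  have key : symp (edgeLabel L v e) (edgeLabel L v f) =
      symp (jordanWigner (G.tail e) + jordanWigner (G.head e))
        (jordanWigner (G.tail f) + jordanWigner (G.head f)) := by
    simp only [edgeLabel, map_add, LinearMap.add_apply, hs]
    have : (4 : ZMod 2) = 0 := rfl
    linear_combination this
  have hsign : ∀ z : ZMod 2, Pauli.sign z * Pauli.sign z = 1 := by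
    intro z; unfold Pauli.sign; split_ifs <;> norm_num
  rw [Commute, SemiconjBy, dressedEdge, dressedEdge, ← Matrix.mul_kronecker_mul,
    ← Matrix.mul_kronecker_mul,
    (hasLabel_I_smul_edgeOp hl L (joins_tail_head e)).comm
      (hasLabel_I_smul_edgeOp hl L (joins_tail_head f)), (hfl e).comm (hfl f), key,
    Matrix.smul_kronecker, Matrix.kronecker_smul, smul_smul, hsign, one_smul]

/-- One list of edges controls both the operator, through dressed edges, and its label, through edge
labels. Inverses correspond to reversed lists because dressed edges are involutions. -/
theorem kronecker_one_of_mem_stabilizer {v : G.ModeLabels}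
    (hl : ∀ i p, HasLabel (γ i p) (v i p)) {s : (Op G.Qubit)ˣ} (hs : s ∈ stabilizer L γ) :
    ∃ l : List E, (s : Op G.Qubit) ⊗ₖ (1 : Op V) = (l.map (dressedEdge L γ)).prod ∧
      HasLabel (s : Op G.Qubit) (l.map (edgeLabel L v)).sum := by
  have hrev : ∀ l : List E, (l.map (dressedEdge L γ)).prod * (l.reverse.map (dressedEdge L γ)).prod
      = 1 := by
    intro l
    induction l with
    | nil => simp
    | cons a l ih =>
      rw [List.map_cons, List.prod_cons, List.reverse_cons, List.map_append, List.prod_append,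
        mul_assoc, ← mul_assoc (List.prod _) (List.prod _), ih]
      simp [dressedEdge_mul_self h]
  induction hs using Subgroup.closure_induction with
  | mem s hs =>
    obtain ⟨u, ζ, hζ⟩ := hs
    refine ⟨ζ.edges, ?_, ?_⟩
    · rw [hζ, ← walkOp_kronecker h, fermion_mul_self]
    · rw [hζ]
      exact hasLabel_walkOp hl L ζ
  | one => exact ⟨[], Matrix.one_kronecker_one, HasLabel.one⟩
  | mul s t _ _ hs ht =>
    obtain ⟨l, h1, h2⟩ := hs
    obtain ⟨m, h3, h4⟩ := ht
    refine ⟨l ++ m, ?_, ?_⟩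
    · rw [List.map_append, List.prod_append, ← h1, ← h3, ← Matrix.mul_kronecker_mul, one_mul,
        Units.val_mul]
    · rw [List.map_append, List.sum_append]
      exact h2.mul h4
  | inv s _ hs =>
    obtain ⟨l, h1, h2⟩ := hs
    refine ⟨l.reverse, ?_, ?_⟩
    · calc ((s⁻¹ : (Op G.Qubit)ˣ) : Op G.Qubit) ⊗ₖ (1 : Op V)
          = ((s⁻¹ : (Op G.Qubit)ˣ) : Op G.Qubit) ⊗ₖ (1 : Op V) *
            ((l.map (dressedEdge L γ)).prod * (l.reverse.map (dressedEdge L γ)).prod) := by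
              rw [hrev, mul_one]
        _ = _ := by
              rw [← h1, ← mul_assoc, ← Matrix.mul_kronecker_mul, Units.inv_mul, one_mul,
                Matrix.one_kronecker_one, one_mul]
    · obtain ⟨B, hB, hB1, -⟩ := h2.exists_inv
      rw [List.map_reverse, List.sum_reverse, Units.inv_eq_of_mul_eq_one_right hB1]
      exact hB

end

end Multigraph

namespace Multigraph

variable {V E : Type*} {G : Multigraph V E}

/-! ### Walks and potentials -/

theorem ThreeConnected.induction (hconn : G.ThreeConnected) {T : Finset V} (hT : T.card < 3)
    {r : V → Prop} {a b : V} (ha : a ∉ T) (hb : b ∉ T) (base : r a)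
    (step : ∀ b c e, b ∉ T → c ∉ T → G.Joins e b c → r b → r c) : r b := by
  have h := (hconn T hT).preconnected ⟨a, ha⟩ ⟨b, hb⟩
  rw [SimpleGraph.reachable_iff_reflTransGen] at h
  suffices ∀ c, Relation.ReflTransGen (G.toSimple.induce {v | v ∉ T}).Adj ⟨a, ha⟩ c → r c.1 from
    this _ h
  intro c hc
  induction hc with
  | refl => exact base
  | @tail b c _ hbc ih =>
    obtain ⟨e, he⟩ : ∃ e, G.Joins e b.1 c.1 := hbc
    exact step _ _ e b.2 c.2 he ih

theorem Walk.exists_append : ∀ {i j k : V} (p : G.Walk i j) (q : G.Walk j k),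
    ∃ r : G.Walk i k, r.edges = p.edges ++ q.edges
  | _, _, _, .nil _, q => ⟨q, rfl⟩
  | _, _, _, .cons e h p, q => by
    obtain ⟨r, hr⟩ := exists_append p q
    exact ⟨.cons e h r, congrArg (e :: ·) hr⟩

theorem Joins.symm {e : E} {i j : V} (h : G.Joins e i j) : G.Joins e j i :=
  h.elim (fun h => Or.inr ⟨h.2, h.1⟩) (fun h => Or.inl ⟨h.2, h.1⟩)

theorem Walk.exists_reverse : ∀ {i j : V} (p : G.Walk i j),
    ∃ r : G.Walk j i, r.edges = p.edges.reverse
  | _, _, .nil u => ⟨.nil u, rfl⟩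
  | _, _, .cons e h p => by
    obtain ⟨r, hr⟩ := exists_reverse p
    obtain ⟨r', hr'⟩ := exists_append r (.cons e h.symm (.nil _))
    exact ⟨r', by rw [hr', hr]; simp [Walk.edges]⟩

/-- An edge function that sums to zero along closed walks is the coboundary of a vertex function. -/
theorem exists_potential (hconn : G.ThreeConnected) (y : E → ZMod 2)
    (hy : ∀ (u : V) (ζ : G.Walk u u), (ζ.edges.map y).sum = 0) :
    ∃ t : V → ZMod 2, ∀ e j k, G.Joins e j k → y e = t j + t k := by
  obtain ⟨⟨r, -⟩⟩ := (hconn ∅ (by simp)).nonempty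
  have hw : ∀ b, Nonempty (G.Walk r b) := fun b =>
    hconn.induction (T := ∅) (by simp) (r := fun b => Nonempty (G.Walk r b)) (Finset.notMem_empty r)
      (Finset.notMem_empty b) ⟨.nil r⟩ fun b c e _ _ h ⟨p⟩ =>
        ⟨(Walk.exists_append p (.cons e h (.nil c))).choose⟩
  refine ⟨fun b => ((hw b).some.edges.map y).sum, fun e j k h => ?_⟩
  obtain ⟨q, hq⟩ := (hw k).some.exists_reverse
  -- The closed walk from the root to `j`, across `e`, and back from `k` to the root.
  obtain ⟨ζ, hζ⟩ := (hw j).some.exists_append (.cons e h q)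
  have := hy r ζ
  rw [hζ, Walk.edges, hq, List.map_append, List.sum_append, List.map_cons, List.sum_cons,
    List.map_reverse, List.sum_reverse, add_left_comm, CharTwo.add_eq_zero] at this
  exact this

/-! ### The stabilizer group -/

/-- The edge with label `p` at the vertex `i`. -/
def Labelling.edge (L : G.Labelling) (i : V) (p : Fin (G.degree i)) : E := ((L i).toFun p).1

theorem Labelling.inc_edge (L : G.Labelling) (i : V) (p : Fin (G.degree i)) :
    G.Inc (L.edge i p) i := ((L i).toFun p).2

theorem Labelling.edge_eq_iff (L : G.Labelling) {i : V} {e : E} (he : G.Inc e i)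
    (p : Fin (G.degree i)) : L.edge i p = e ↔ p = L.label i e he :=
  ⟨fun h => (Equiv.eq_symm_apply (L i)).2 (Subtype.ext h), fun h => by
    rw [h]; exact congrArg Subtype.val (Equiv.apply_symm_apply (L i) ⟨e, he⟩)⟩

theorem Labelling.edge_label (L : G.Labelling) {i : V} {e : E} (he : G.Inc e i) :
    L.edge i (L.label i e he) = e := (L.edge_eq_iff he _).2 rfl

theorem Labelling.label_edge (L : G.Labelling) (i : V) (p : Fin (G.degree i)) :
    L.label i (L.edge i p) (L.inc_edge i p) = p := ((L.edge_eq_iff _ p).1 rfl).symm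

variable [Fintype V] [DecidableEq V]

theorem comb_indicator (v : G.ModeLabels) (L : G.Labelling) [DecidableEq E] (e : E) :
    comb v (fun i p => if L.edge i p = e then 1 else 0) = edgeLabel L v e := by
  have hloc : ∀ i (hi : G.Inc e i),
      localComb v i (fun p => if L.edge i p = e then 1 else 0) = v i (L.label i e hi) := by
    intro i hi
    rw [← localComb_single v]
    congr 1
    funext p
    simp [L.edge_eq_iff hi, Pi.single_apply]
  rw [comb, Fintype.sum_eq_add _ _ (G.tail_ne_head e), hloc _ (Or.inl rfl), hloc _ (Or.inr rfl)]
  · rfl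
  · rintro i ⟨h1, h2⟩
    rw [← localComb_zero v i]
    congr 1
    funext p
    refine if_neg fun h => ?_
    rcases L.inc_edge i p with h' | h' <;> rw [h] at h'
    exacts [h1 h'.symm, h2 h'.symm]

/-- The half-edge coordinates of a product of edge operators are the multiplicities modulo `2`, so
by injectivity of `comb` the label determines their parities. -/
theorem comb_count (v : G.ModeLabels) (L : G.Labelling) [DecidableEq E] (l : List E) :
    comb v (fun i p => (l.count (L.edge i p) : ZMod 2)) = (l.map (edgeLabel L v)).sum := by
  induction l with
  | nil => exact comb_zero v
  | cons e l ih =>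
    rw [List.map_cons, List.sum_cons, ← ih, ← comb_indicator, ← comb_add]
    congr 1
    funext i p
    rw [List.count_cons, Pi.add_apply, Pi.add_apply]
    rw [Nat.cast_add, add_comm]
    simp only [beq_iff_eq, eq_comm (a := e), Nat.cast_ite, Nat.cast_one, Nat.cast_zero]

open scoped Kronecker in
theorem kronecker_one_injective {A B : Op G.Qubit} (h : A ⊗ₖ (1 : Op V) = B ⊗ₖ (1 : Op V)) :
    A = B := by
  ext a b
  have := congrFun (congrFun h (a, 0)) (b, 0)
  simpa using this

theorem isStabilizerGroup {γ : G.Modes} (h : G.IsLocalMajorana γ) (L : G.Labelling)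
    (heven : ∀ i, Even (G.degree i)) : IsStabilizerGroup (stabilizer L γ) := by
  classical
  obtain ⟨v, hv, hl⟩ := h.exists_labels
  refine ⟨fun s hs => ?_, fun s hs t ht => ?_, fun hs => ?_⟩
  · obtain ⟨l, -, h2⟩ := kronecker_one_of_mem_stabilizer h L hl hs
    exact h2.isPauli
  · obtain ⟨l, h1, -⟩ := kronecker_one_of_mem_stabilizer h L hl hs
    obtain ⟨m, h2, -⟩ := kronecker_one_of_mem_stabilizer h L hl ht
    refine Units.ext (kronecker_one_injective ?_)
    rw [Units.val_mul, Units.val_mul, ← one_mul (1 : Op V), Matrix.mul_kronecker_mul,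
      Matrix.mul_kronecker_mul, h1, h2, ← List.prod_append, ← List.prod_append, ← List.map_append,
      ← List.map_append]
    exact (List.perm_append_comm.map _).prod_eq'
      (List.pairwise_map.2 (List.pairwise_of_forall fun e f => dressedEdge_commute h L e f))
  · obtain ⟨l, h1, h2⟩ := kronecker_one_of_mem_stabilizer h L hl hs
    have h3 : HasLabel ((-1 : (Op G.Qubit)ˣ) : Op G.Qubit) 0 := by
      rw [Units.val_neg, Units.val_one, ← neg_one_smul ℂ]
      exact HasLabel.one.smul (by norm_num)
    have h4 := h2.unique h3
    rw [← comb_count, ← comb_zero v] at h4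
    have h5 := hv.comb_injective heven h4
    -- The label of `-1` is zero, so every edge occurs evenly; the commuting involutions then
    -- multiply to `1`, not `-1`.
    have h6 : ∀ e, Even (l.count e) := by
      intro e
      have := congrFun (congrFun h5 (G.tail e)) (L.label _ e (joins_tail_head e).inc_left)
      rwa [L.edge_label, Pi.zero_apply, Pi.zero_apply,
        ZMod.natCast_eq_zero_iff_even] at this
    rw [prod_map_eq_one_of_even_count _ (dressedEdge_commute h L) (dressedEdge_mul_self h L) l h6,
      ← Matrix.one_kronecker_one] at h1
    have h7 := kronecker_one_injective h1
    rw [Units.val_neg, Units.val_one, neg_eq_iff_add_eq_zero] at h7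
    exact one_ne_zero (op_eq_zero_of_add_self h7)

/-! ### The distance -/

theorem wt_localComb_le {v : G.ModeLabels} (hv : IsModeLabels v)
    (x : (i : V) → Fin (G.degree i) → ZMod 2) (i : V) : wt (localComb v i (x i)) ≤ wt (comb v x) := by
  refine Set.ncard_le_ncard (fun q hq => ?_) (Set.toFinite _)
  by_cases hi : q.1 = i
  · subst hi
    rwa [Set.mem_ofPred_eq, hv.comb_apply]
  · exact absurd (hv.localComb_apply_of_ne _ hi) hq

theorem wt_localComb_add_le {v : G.ModeLabels} (hv : IsModeLabels v)
    (x : (i : V) → Fin (G.degree i) → ZMod 2) {i j : V} (hij : i ≠ j) :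
    wt (localComb v i (x i)) + wt (localComb v j (x j)) ≤ wt (comb v x) := by
  rw [wt, wt, ← Set.ncard_union_eq]
  · refine Set.ncard_le_ncard (fun q hq => ?_) (Set.toFinite _)
    rw [Set.mem_ofPred_eq, hv.comb_apply]
    rcases hq with hq | hq
    · by_cases hi : q.1 = i
      · subst hi; exact hq
      · exact absurd (hv.localComb_apply_of_ne _ hi) hq
    · by_cases hi : q.1 = j
      · subst hi; exact hq
      · exact absurd (hv.localComb_apply_of_ne _ hi) hq
  · refine Set.disjoint_left.2 fun q hi hj => hij ?_
    by_contra hne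
    by_cases h : q.1 = i
    · exact hj (hv.localComb_apply_of_ne _ (h ▸ hne))
    · exact hi (hv.localComb_apply_of_ne _ h)

theorem wt_pos {Q : Type*} [Fintype Q] {w : Q → Pauli} (h : w ≠ 0) : 1 ≤ wt w := by
  obtain ⟨q, hq⟩ := Function.ne_iff.1 h
  exact (Set.ncard_pos (Set.toFinite _)).2 ⟨q, hq⟩

/-- The weight conditions, in terms of labels. -/
structure LabelConditions (v : G.ModeLabels) : Prop where
  vertex : ∀ i, 3 ≤ wt (localComb v i 1)
  mode : ∀ i p, 2 ≤ wt (v i p)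
  vertex_mode : ∀ i p, 2 ≤ wt (localComb v i 1 + v i p)
  vertex_mode_mode : ∀ i p q, p ≠ q → 2 ≤ wt (localComb v i 1 + v i p + v i q)

theorem weightConditions_iff {γ : G.Modes} {v : G.ModeLabels}
    (hl : ∀ i p, HasLabel (γ i p) (v i p)) : WeightConditions γ ↔ LabelConditions v := by
  have h1 := fun i => hasLabel_vertexOp hl i
  have h2 := fun i p => (h1 i).mul (hl i p)
  have h3 := fun i p q => (h2 i p).mul (hl i q)
  constructor
  · rintro ⟨a, b, c, d⟩
    simp only [fun i p => (hl i p).weight_eq, fun i => (h1 i).weight_eq,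
      fun i p => (h2 i p).weight_eq, fun i p q => (h3 i p q).weight_eq] at a b c d
    refine ⟨a, b, c, fun i p q hpq => ?_⟩
    rcases lt_or_gt_of_ne hpq with h | h
    · exact d i p q h
    · rw [add_right_comm]
      exact d i q p h
  · rintro ⟨a, b, c, d⟩
    refine ⟨fun i => ?_, fun i p => ?_, fun i p => ?_, fun i p q hpq => ?_⟩
    · rw [(h1 i).weight_eq]; exact a i
    · rw [(hl i p).weight_eq]; exact b i p
    · rw [(h2 i p).weight_eq]; exact c i p
    · rw [(h3 i p q).weight_eq]; exact d i p q hpq.ne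

/-- A label of weight at most two that commutes with all closed walks is trivial, or the label of a
closed walk. -/
theorem eq_zero_or_closed_walk [Finite E] (hconn : G.ThreeConnected)
    (heven : ∀ i, Even (G.degree i)) (hmult : ∀ i j, {e | G.Joins e i j}.ncard ≤ 2)
    {v : G.ModeLabels} (hv : IsModeLabels v) (hc : LabelConditions v) (L : G.Labelling)
    {w : G.Qubit → Pauli}
    (hw : ∀ (u : V) (ζ : G.Walk u u), symp w (ζ.edges.map (edgeLabel L v)).sum = 0)
    (hwt : wt w < 3) :
    w = 0 ∨ ∃ (u : V) (ζ : G.Walk u u), w = (ζ.edges.map (edgeLabel L v)).sum := by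
  classical
  obtain ⟨x, rfl⟩ := hv.comb_surjective heven w
  obtain ⟨t₀, ht₀⟩ := exists_potential hconn (fun e => symp (comb v x) (edgeLabel L v e))
    -- The syndrome of `w` on edges sums to zero along closed walks, hence comes from a vertex
    -- potential.
    (fun u ζ => by rw [← hw u ζ, map_list_sum, List.map_map]; rfl)
  have hpot : ∃ t : V → ZMod 2, ∀ e j k (h : G.Joins e j k),
      x j (L.label j e h.inc_left) + t j = x k (L.label k e h.inc_right) + t k := by
    -- By `symp_comb`, anticommuting with a mode is measured by the local total plus one bit; the
    -- total is absorbed into the potential.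
    refine ⟨fun i => t₀ i + ∑ p, x i p, fun e j k h => ?_⟩
    have := ht₀ e j k h
    simp only [edgeLabel_eq L v h, map_add, hv.symp_comb] at this
    rw [← CharTwo.add_eq_zero] at this ⊢
    rw [← this]
    ring
  obtain ⟨t₁, ht₁⟩ := hpot
  set T : Finset V := (Finset.univ.filter fun q => comb v x q ≠ 0).image Sigma.fst with hTdef
  have hT : T.card < 3 := by
    refine lt_of_le_of_lt Finset.card_image_le ?_
    rw [← Set.ncard_coe_finset]
    simpa [wt] using hwt
  have hx0 : ∀ k, k ∉ T → x k = 0 := by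
    intro k hk
    refine hv.localComb_injective heven k ?_
    rw [localComb_zero]
    funext q
    by_cases hq : q.1 = k
    · subst hq
      by_contra h
      rw [← hv.comb_apply] at h
      exact hk (Finset.mem_image_of_mem _ (Finset.mem_filter.2 ⟨Finset.mem_univ _, h⟩))
    · exact hv.localComb_apply_of_ne _ hq
  -- Off `T` all bits vanish, so the potential is constant along edges avoiding `T`. The rest of the
  -- graph is connected, and a global shift makes that constant `0`.
  have hnorm : ∃ t : V → ZMod 2, (∀ k, k ∉ T → t k = 0) ∧ ∀ e j k (h : G.Joins e j k),
      x j (L.label j e h.inc_left) + t j = x k (L.label k e h.inc_right) + t k := by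
    obtain ⟨⟨a, ha⟩⟩ := (hconn T hT).nonempty
    refine ⟨fun k => t₁ k + t₁ a, fun k hk => ?_, fun e j k h => ?_⟩
    · rw [CharTwo.add_eq_zero]
      refine hconn.induction (r := fun k => t₁ k = t₁ a) hT ha hk rfl fun b c e hb hc' h ih => ?_
      have := ht₁ e b c h
      rw [hx0 b hb, hx0 c hc', Pi.zero_apply, Pi.zero_apply, zero_add, zero_add] at this
      exact this.symm.trans ih
    · rw [← add_assoc, ht₁ e j k h, add_assoc]
  obtain ⟨t, htT, ht⟩ := hnorm
  -- The common value at the two ends of an edge. Thus `t` records the vertex operators and `D` the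
  -- edge operators in a factorisation of `w`.
  let D : E → ZMod 2 := fun e => x _ (L.label _ e (joins_tail_head e).inc_left) + t (G.tail e)
  have hD : ∀ i e (h : G.Inc e i), x i (L.label i e h) = t i + D e := by
    rintro i e (rfl | rfl)
    · change _ = t _ + (x _ (L.label _ e (joins_tail_head e).inc_left) + t _)
      rw [add_comm (x _ _), CharTwo.add_cancel_left]
    · change _ = t _ + (x _ (L.label _ e (joins_tail_head e).inc_left) + t _)
      rw [ht e _ _ (joins_tail_head e), add_comm (x _ _), CharTwo.add_cancel_left]
  have hD' : ∀ i p, x i p = t i + D (L.edge i p) := by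
    intro i p
    rw [← hD i _ (L.inc_edge i p), L.label_edge]
  have hDT : ∀ e i, G.Inc e i → D e = 1 → i ∈ T := by
    intro e i h he
    by_contra hi
    have := hD i e h
    rw [hx0 i hi, htT i hi, he, Pi.zero_apply, zero_add] at this
    exact zero_ne_one this
  -- With no edge operators, `w` is a product of vertex operators, and a single one already has
  -- weight at least three.
  by_cases hall : ∀ e, D e = 0
  · left
    by_cases h0 : ∀ i, t i = 0
    · rw [← comb_zero v]
      congr 1
      funext i p
      rw [hD', h0, hall]
      rfl
    · push Not at h0
      obtain ⟨i, hi⟩ := h0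
      have hi := (zmod_two_cases (t i)).resolve_left hi
      have hxi : x i = 1 := funext fun p => by rw [hD', hi, hall, add_zero, Pi.one_apply]
      have h1 := wt_localComb_le hv x i
      rw [hxi] at h1
      exact absurd ((hc.vertex i).trans h1) (not_le_of_gt hwt)
  push Not at hall
  obtain ⟨e, he⟩ := hall
  have he := (zmod_two_cases (D e)).resolve_left he
  obtain ⟨i, j, hij⟩ : ∃ i j, G.Joins e i j := ⟨_, _, joins_tail_head e⟩
  have hne := joins_ne hij
  have hTij : T = {i, j} := by
    refine (Finset.eq_of_subset_of_card_le ?_ ?_).symm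
    · rw [Finset.insert_subset_iff, Finset.singleton_subset_iff]
      exact ⟨hDT e i hij.inc_left he, hDT e j hij.inc_right he⟩
    · rw [Finset.card_pair hne]
      omega
  have hjoin : ∀ f, D f = 1 → G.Joins f i j := by
    intro f hf
    have h1 := hDT f _ (joins_tail_head f).inc_left hf
    have h2 := hDT f _ (joins_tail_head f).inc_right hf
    have h3 := G.tail_ne_head f
    rw [hTij, Finset.mem_insert, Finset.mem_singleton] at h1 h2
    rcases h1 with h1 | h1 <;> rcases h2 with h2 | h2
    · exact absurd (h1.trans h2.symm) h3
    · exact Or.inl ⟨h1, h2⟩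
    · exact Or.inr ⟨h2, h1⟩
    · exact absurd (h1.trans h2.symm) h3
  -- The edges with `D = 1` all join `i` and `j`: either two parallel edges or `e` alone.
  by_cases hone : ∃ f, f ≠ e ∧ D f = 1
  · obtain ⟨f, hfe, hf⟩ := hone
    have hDef : ∀ g, D g = (if g = e then 1 else 0) + if g = f then 1 else 0 := by
      intro g
      by_cases h1 : g = e
      · rw [h1, he, if_pos rfl, if_neg (Ne.symm hfe), add_zero]
      by_cases h2 : g = f
      · rw [h2, hf, if_pos rfl, if_neg hfe, zero_add]
      rw [if_neg h1, if_neg h2, add_zero]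
      refine (zmod_two_cases _).resolve_right fun hg => ?_
      have hsub : (({g, e, f} : Finset E) : Set E) ⊆ {e | G.Joins e i j} := by
        intro a ha
        rw [Finset.mem_coe, Finset.mem_insert, Finset.mem_insert, Finset.mem_singleton] at ha
        rcases ha with rfl | rfl | rfl
        exacts [hjoin _ hg, hij, hjoin _ hf]
      have := (Set.ncard_le_ncard hsub (Set.toFinite _)).trans (hmult i j)
      rw [Set.ncard_coe_finset, Finset.card_eq_three.2 ⟨g, e, f, h1, h2, Ne.symm hfe, rfl⟩] at this
      omega
    -- Without vertex operators, `w` is the closed walk along `e` and back along `f`. Otherwise one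
    -- end contributes weight at least `2` and the other at least `1`.
    by_cases h0 : t i = 0 ∧ t j = 0
    · right
      refine ⟨i, .cons e hij (.cons f (hjoin f hf).symm (.nil i)), ?_⟩
      have hl : (Walk.cons e hij (.cons f (hjoin f hf).symm (.nil i)) : G.Walk i i).edges = [e, f] :=
        rfl
      rw [hl, List.map_cons, List.map_singleton, List.sum_cons, List.sum_singleton,
        ← comb_indicator, ← comb_indicator, ← comb_add]
      congr 1
      funext k p
      have htk : t k = 0 := by
        by_cases hk : k ∈ T
        · rw [hTij, Finset.mem_insert, Finset.mem_singleton] at hk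
          rcases hk with rfl | rfl
          exacts [h0.1, h0.2]
        · exact htT k hk
      rw [hD', htk, zero_add, hDef]
      rfl
    · have hloc : ∀ k (hek : G.Inc e k) (hfk : G.Inc f k),
          1 ≤ wt (localComb v k (x k)) ∧ (t k = 1 → 2 ≤ wt (localComb v k (x k))) := by
        intro k hek hfk
        have hpq : L.label k e hek ≠ L.label k f hfk := by
          rw [Ne, L.label_inj]
          exact Ne.symm hfe
        have hxk : x k = (fun _ => t k) + Pi.single (L.label k e hek) 1 +
            Pi.single (L.label k f hfk) 1 := by
          funext p
          simp only [hD', hDef, L.edge_eq_iff hek, L.edge_eq_iff hfk, Pi.add_apply, Pi.single_apply, add_assoc]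
        have h2 : t k = 1 → 2 ≤ wt (localComb v k (x k)) := by
          intro htk
          rw [hxk, htk, localComb_add, localComb_add, localComb_single, localComb_single]
          exact hc.vertex_mode_mode k _ _ hpq
        refine ⟨?_, h2⟩
        rcases zmod_two_cases (t k) with htk | htk
        -- The product of two distinct modes is non-trivial because it anticommutes with the second
        -- of them.
        · refine wt_pos fun h => ?_
          have h3 : (fun _ : Fin (G.degree k) => (0 : ZMod 2)) = 0 := rfl
          rw [hxk, htk, localComb_add, localComb_add, localComb_single, localComb_single, h3,
            localComb_zero, zero_add] at h
          have h4 := congrArg (fun u => symp u (v k (L.label k f hfk))) h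
          simp [hv.symp_eq_one k _ _ hpq, symp_self] at h4
        · exact le_trans (by norm_num) (h2 htk)
      have hi := hloc i hij.inc_left (hjoin f hf).inc_left
      have hj := hloc j hij.inc_right (hjoin f hf).inc_right
      have hsum := wt_localComb_add_le hv x hne
      rw [not_and_or] at h0
      rcases h0 with h0 | h0
      · have := hi.2 ((zmod_two_cases _).resolve_left h0)
        omega
      · have := hj.2 ((zmod_two_cases _).resolve_left h0)
        omega
  · push Not at hone
    have hDe : ∀ g, D g = if g = e then 1 else 0 := by
      intro g
      split_ifs with h
      · rw [h, he]
      · exact (zmod_two_cases _).resolve_right (hone g h)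
    -- With one edge, the part of `w` at either end is a mode, possibly times the vertex operator;
    -- both have weight at least `2`, for a total of at least `4`.
    have hloc : ∀ k (_ : G.Inc e k), 2 ≤ wt (localComb v k (x k)) := by
      intro k hek
      have hxk : x k = (fun _ => t k) + Pi.single (L.label k e hek) 1 := by
        funext p
        simp only [hD', hDe, L.edge_eq_iff hek, Pi.add_apply, Pi.single_apply]
      rw [hxk, localComb_add, localComb_single]
      rcases zmod_two_cases (t k) with htk | htk
      · have h3 : (fun _ : Fin (G.degree k) => (0 : ZMod 2)) = 0 := rfl
        rw [htk, h3, localComb_zero, zero_add]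
        exact hc.mode k _
      · rw [htk]
        exact hc.vertex_mode k _
    have hsum := wt_localComb_add_le hv x hne
    have hi := hloc i hij.inc_left
    have hj := hloc j hij.inc_right
    omega

/-- A low-weight operator commuting with the stabilizer is a phase times the identity or a
closed-walk operator, and so acts as a scalar on the codespace. -/
theorem correctsSingleQubitErrors [Finite E] (hconn : G.ThreeConnected)
    (heven : ∀ i, Even (G.degree i)) (hmult : ∀ i j, {e | G.Joins e i j}.ncard ≤ 2)
    {γ : G.Modes} (h : G.IsLocalMajorana γ) (hW : WeightConditions γ) (L : G.Labelling) :
    CorrectsSingleQubitErrors (stabilizer L γ) := by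
  rintro O ⟨hO, hcomm, hns⟩
  by_contra hwt
  obtain ⟨v, hv, hl⟩ := h.exists_labels
  obtain ⟨w, hw⟩ := isPauli_iff.1 hO
  rw [hw.weight_eq, not_le] at hwt
  have hmem : ∀ (u : V) (ζ : G.Walk u u), ∃ s ∈ stabilizer L γ, (s : Op G.Qubit) = walkOp L γ ζ := by
    intro u ζ
    obtain ⟨B, -, h1, h2⟩ := (hasLabel_walkOp hl L ζ).exists_inv
    exact ⟨⟨_, B, h1, h2⟩, Subgroup.subset_closure ⟨u, ζ, rfl⟩, rfl⟩
  have hw0 : ∀ (u : V) (ζ : G.Walk u u), symp w (ζ.edges.map (edgeLabel L v)).sum = 0 := by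
    intro u ζ
    obtain ⟨s, hs, hs'⟩ := hmem u ζ
    have := hcomm s hs
    rw [hs'] at this
    exact hw.symp_eq_zero (hasLabel_walkOp hl L ζ) this
  refine hns ?_
  rcases eq_zero_or_closed_walk hconn heven hmult hv ((weightConditions_iff hl).1 hW) L hw0 hwt
    with rfl | ⟨u, ζ, rfl⟩
  · obtain ⟨c, -, rfl⟩ := hw.eq_smul HasLabel.one
    exact ⟨c, fun ψ _ => by rw [Matrix.smul_mulVec, Matrix.one_mulVec]⟩
  · obtain ⟨c, -, rfl⟩ := hw.eq_smul (hasLabel_walkOp hl L ζ)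
    obtain ⟨s, hs, hs'⟩ := hmem u ζ
    exact ⟨c, fun ψ hψ => by rw [Matrix.smul_mulVec, ← hs', hψ s hs]⟩

end Multigraph

namespace Multigraph

/-! ### The explicit modes at one vertex -/

/-- The qubit on which the explicit mode has `X` or `Y`. -/
def explicitPos (d p : ℕ) : ℕ := (d / 2 / 2 + p / 2) % (d / 2)

/-- The qubit `t` is among the qubits preceding `a` on which the explicit modes at `a` have `Z`. -/
def Precedes (n t a : ℕ) : Prop := 2 * ((a + n - t) % n) < n ∨ 2 * ((a + n - t) % n) = n ∧ t < a

instance (n t a : ℕ) : Decidable (Precedes n t a) := inferInstanceAs (Decidable (_ ∨ _))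

theorem cyclic_sub {n a t : ℕ} (ha : a < n) (ht : t < n) :
    (a + n - t) % n = if t ≤ a then a - t else a + n - t := by
  split_ifs with h
  · rw [Nat.sub_add_comm h, Nat.add_mod_right, Nat.mod_eq_of_lt (by omega)]
  · rw [Nat.mod_eq_of_lt (by omega)]

/-- The two cyclic distances between distinct positions add up to `n`, so exactly one is below `n /
2`, unless both equal it; then the order of the positions breaks the tie. -/
theorem precedes_iff_not_precedes {n a b : ℕ} (ha : a < n) (hb : b < n) (hab : a ≠ b) :
    Precedes n a b ↔ ¬ Precedes n b a := by
  rw [Precedes, Precedes, cyclic_sub ha hb, cyclic_sub hb ha]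
  split_ifs <;> omega

theorem explicitPauli_eq (d p t : ℕ) : explicitPauli d p t =
    if t = explicitPos d p then (if p % 2 = 0 then .X else .Y)
    else if Precedes (d / 2) t (explicitPos d p) then .Z else .I := rfl

theorem explicitPos_lt {d : ℕ} (hd : 6 ≤ d) (p : ℕ) : explicitPos d p < d / 2 :=
  Nat.mod_lt _ (by omega)

theorem explicitPos_inj {d p q : ℕ} (hp : p < d) (hq : q < d) (hd : Even d)
    (h : explicitPos d p = explicitPos d q) : p / 2 = q / 2 := by
  obtain ⟨k, rfl⟩ := hd
  exact (Nat.ModEq.add_left_cancel' _ h).eq_of_lt_of_lt (by omega) (by omega)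

theorem explicitPauli_pos (d p : ℕ) : explicitPauli d p (explicitPos d p) = .X ∨
    explicitPauli d p (explicitPos d p) = .Y := by
  rw [explicitPauli_eq, if_pos rfl]
  split_ifs <;> simp

theorem explicitPauli_of_ne {d p t : ℕ} (h : t ≠ explicitPos d p) :
    explicitPauli d p t = .I ∨ explicitPauli d p t = .Z := by
  rw [explicitPauli_eq, if_neg h]
  split_ifs <;> simp

/-- The explicit modes at a vertex anticommute. -/
theorem sum_form_explicitPauli {d p q : ℕ} (hd : Even d) (hd6 : 6 ≤ d) (hp : p < d) (hq : q < d)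
    (hpq : p ≠ q) :
    ∑ t : Fin (d / 2), (explicitPauli d p t).form (explicitPauli d q t) = 1 := by
  have hpl := explicitPos_lt hd6 p
  have hql := explicitPos_lt hd6 q
  by_cases h : explicitPos d p = explicitPos d q
  -- Equal positions: one mode has `X` there, the other `Y`, and they agree on all other qubits.
  · have h2 := explicitPos_inj hp hq hd h
    rw [Fintype.sum_eq_single ⟨explicitPos d p, hpl⟩]
    · rw [explicitPauli_eq, explicitPauli_eq, if_pos rfl, if_pos h]
      rcases Nat.mod_two_eq_zero_or_one p with h3 | h3 <;>
        rcases Nat.mod_two_eq_zero_or_one q with h4 | h4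
      · omega
      · rw [h3, h4]; decide
      · rw [h3, h4]; decide
      · omega
    · intro t ht
      have ht' : (t : ℕ) ≠ explicitPos d p := fun e => ht (Fin.ext e)
      rw [explicitPauli_eq, explicitPauli_eq, ← h, if_neg ht', if_neg ht']
      simp [Pauli.form]
  -- Different positions: exactly one of the two modes has `Z` at the position of the other, and all
  -- remaining qubits carry only `Z` or `I`.
  · have hne : (⟨explicitPos d p, hpl⟩ : Fin (d / 2)) ≠ ⟨explicitPos d q, hql⟩ :=
      fun e => h (congrArg Fin.val e)
    rw [Fintype.sum_eq_add _ _ hne]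
    · have h1 := precedes_iff_not_precedes hpl hql h
      have h2 := explicitPauli_pos d p
      have h3 := explicitPauli_pos d q
      dsimp only
      have h4 : explicitPauli d q (explicitPos d p) =
          if Precedes (d / 2) (explicitPos d p) (explicitPos d q) then .Z else .I := by
        rw [explicitPauli_eq, if_neg h]
      have h5 : explicitPauli d p (explicitPos d q) =
          if Precedes (d / 2) (explicitPos d q) (explicitPos d p) then .Z else .I := by
        rw [explicitPauli_eq, if_neg (Ne.symm h)]
      rw [h4, h5]
      by_cases h6 : Precedes (d / 2) (explicitPos d p) (explicitPos d q)
      · rw [if_pos h6, if_neg (h1.1 h6)]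
        rcases h2 with h2 | h2 <;> rcases h3 with h3 | h3 <;> rw [h2, h3] <;> decide
      · rw [if_neg h6, if_pos (not_not.1 (mt h1.2 h6))]
        rcases h2 with h2 | h2 <;> rcases h3 with h3 | h3 <;> rw [h2, h3] <;> decide
    · rintro t ⟨h1, h2⟩
      rcases explicitPauli_of_ne (d := d) (p := p) (t := t) (fun e => h1 (Fin.ext e)) with h3 | h3 <;>
        rcases explicitPauli_of_ne (d := d) (p := q) (t := t) (fun e => h2 (Fin.ext e)) with h4 | h4 <;>
        rw [h3, h4] <;> decide

theorem sum_form_Z_explicitPauli {d : ℕ} (hd6 : 6 ≤ d) (p : ℕ) :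
    ∑ t : Fin (d / 2), Pauli.Z.form (explicitPauli d p t) = 1 := by
  rw [Fintype.sum_eq_single ⟨explicitPos d p, explicitPos_lt hd6 p⟩]
  · rcases explicitPauli_pos d p with h | h <;> simp only [h] <;> decide
  · intro t ht
    rcases explicitPauli_of_ne (d := d) (p := p) (t := t) (fun e => ht (Fin.ext e)) with h | h <;>
      rw [h] <;> decide

/-- The qubit before the position of an explicit mode carries `Z`. -/
theorem exists_explicitPauli_eq_Z {d : ℕ} (hd6 : 6 ≤ d) (p : ℕ) : ∃ t < d / 2,
    t ≠ explicitPos d p ∧ explicitPauli d p t = .Z := by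
  have hpl := explicitPos_lt hd6 p
  -- The cyclic distance is `1`, and `2 < n` since `d ≥ 6`.
  have key : ∀ t < d / 2, (t + 1 = explicitPos d p ∨ explicitPos d p = 0 ∧ t + 1 = d / 2) →
      t ≠ explicitPos d p ∧ explicitPauli d p t = .Z := by
    intro t ht h
    have hne : t ≠ explicitPos d p := by omega
    refine ⟨hne, ?_⟩
    rw [explicitPauli_eq, if_neg hne, if_pos]
    rw [Precedes, cyclic_sub hpl ht]
    split_ifs <;> omega
  by_cases h : explicitPos d p = 0
  · exact ⟨d / 2 - 1, by omega, key _ (by omega) (by omega)⟩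
  · exact ⟨explicitPos d p - 1, by omega, key _ (by omega) (by omega)⟩

/-- The qubit after the position of an explicit mode carries the identity. -/
theorem exists_explicitPauli_eq_I {d : ℕ} (hd6 : 6 ≤ d) (p : ℕ) : ∃ t < d / 2,
    t ≠ explicitPos d p ∧ explicitPauli d p t = .I := by
  have hpl := explicitPos_lt hd6 p
  -- The cyclic distance is `n - 1`, and `2 * (n - 1) > n` since `n ≥ 3`.
  have key : ∀ t < d / 2, (t = explicitPos d p + 1 ∨ t = 0 ∧ explicitPos d p + 1 = d / 2) →
      t ≠ explicitPos d p ∧ explicitPauli d p t = .I := by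
    intro t ht h
    have hne : t ≠ explicitPos d p := by omega
    refine ⟨hne, ?_⟩
    rw [explicitPauli_eq, if_neg hne, if_neg]
    rw [Precedes, cyclic_sub hpl ht]
    split_ifs <;> omega
  by_cases h : explicitPos d p + 1 = d / 2
  · exact ⟨0, by omega, key _ (by omega) (by omega)⟩
  · exact ⟨explicitPos d p + 1, by omega, key _ (by omega) (by omega)⟩

variable {V E : Type*} {G : Multigraph V E} [Fintype V] [DecidableEq V]

/-! ### The explicit modes of the code -/

variable (G) in
/-- The labels of the explicit modes. -/
noncomputable def explicitLabels : G.ModeLabels := fun i p q =>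
  if q.1 = i then explicitPauli (G.degree i) p q.2 else .I

theorem hasLabel_explicitModes (i : V) (p : Fin (G.degree i)) :
    HasLabel (G.explicitModes i p) (G.explicitLabels i p) := hasLabel_pauliOp _

theorem explicitLabels_apply (i : V) (p : Fin (G.degree i)) (t : Fin (G.degree i / 2)) :
    G.explicitLabels i p ⟨i, t⟩ = explicitPauli (G.degree i) p t := if_pos rfl

theorem symp_explicitLabels (w : G.Qubit → Pauli) (i : V) (p : Fin (G.degree i)) :
    symp w (G.explicitLabels i p) =
      ∑ t : Fin (G.degree i / 2), (w ⟨i, t⟩).form (explicitPauli (G.degree i) p t) := by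
  rw [symp_apply, Fintype.sum_sigma, Fintype.sum_eq_single i]
  · simp only [explicitLabels_apply]
  · intro j hj
    refine Finset.sum_eq_zero fun t _ => ?_
    have : G.explicitLabels i p ⟨j, t⟩ = 0 := if_neg hj
    rw [this]
    simp [Pauli.form]

theorem isModeLabels_explicitLabels (hdeg : ∀ i, Even (G.degree i) ∧ 6 ≤ G.degree i) :
    IsModeLabels G.explicitLabels where
  eq_zero i p q hq := if_neg hq
  symp_eq_one i p q hpq := by
    rw [symp_explicitLabels]
    simp only [explicitLabels_apply]
    exact sum_form_explicitPauli (hdeg i).1 (hdeg i).2 p.2 q.2 (fun e => hpq (Fin.ext e))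

theorem isLocalMajorana_explicitModes (hdeg : ∀ i, Even (G.degree i) ∧ 6 ≤ G.degree i) :
    G.IsLocalMajorana G.explicitModes where
  isPauliOn i p := ⟨1, _, one_pow 4, fun q hq => if_neg hq, (one_smul ℂ _).symm⟩
  isHermitian i p := pauliOp_isHermitian _
  anticomm i p q := by
    have hv := isModeLabels_explicitLabels hdeg
    split_ifs with h
    · rw [h, two_nsmul, explicitModes, pauliOp_mul_self]
    · rw [(hasLabel_explicitModes i p).comm (hasLabel_explicitModes i q), hv.symp_eq_one i p q h,
        Pauli.sign, if_neg one_ne_zero, neg_one_smul, neg_add_cancel]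
  generate i O hO := (isModeLabels_explicitLabels hdeg).exists_mem_closure (fun i => (hdeg i).1)
    hasLabel_explicitModes i hO

/-- The vertex operator of the explicit modes acts as `Z` on every qubit of the vertex. -/
theorem localComb_explicitLabels (hdeg : ∀ i, Even (G.degree i) ∧ 6 ≤ G.degree i) (i : V) :
    localComb G.explicitLabels i 1 = fun q => if q.1 = i then .Z else .I := by
  have hv := isModeLabels_explicitLabels hdeg
  rw [← sub_eq_zero]
  -- By nondegeneracy it suffices to compare commutation with all modes. At the vertex `i` both
  -- sides anticommute with every mode, the left one because the degree is even.
  refine hv.eq_zero_of_symp (fun i => (hdeg i).1) fun j p => ?_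
  rw [map_sub, LinearMap.sub_apply, sub_eq_zero]
  by_cases hij : i = j
  · subst hij
    rw [hv.symp_localComb_same, symp_explicitLabels]
    simp only [if_true]
    rw [sum_form_Z_explicitPauli (hdeg i).2]
    simp [(ZMod.natCast_eq_zero_iff_even).2 (hdeg i).1]
  · rw [hv.symp_localComb_of_ne hij, symp_eq_zero_of_disjoint]
    intro q
    by_cases hq : q.1 = i
    · exact Or.inr (hv.eq_zero _ _ _ (hq ▸ hij))
    · exact Or.inl (if_neg hq)

theorem two_le_wt {w : G.Qubit → Pauli} {i : V} {t u : ℕ} (ht : t < G.degree i / 2)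
    (hu : u < G.degree i / 2) (htu : t ≠ u) (h1 : w ⟨i, ⟨t, ht⟩⟩ ≠ 0) (h2 : w ⟨i, ⟨u, hu⟩⟩ ≠ 0) :
    2 ≤ wt w :=
  (Set.one_lt_ncard_iff (Set.toFinite _)).2 ⟨_, _, h1, h2, fun e => htu (by simpa using e)⟩

theorem labelConditions_explicitLabels (hdeg : ∀ i, Even (G.degree i) ∧ 6 ≤ G.degree i) :
    LabelConditions G.explicitLabels := by
  have hlt := fun i => explicitPos_lt (hdeg i).2
  refine ⟨fun i => ?_, fun i p => ?_, fun i p => ?_, fun i p q hpq => ?_⟩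
  · rw [localComb_explicitLabels hdeg]
    have h6 := (hdeg i).2
    refine (Set.two_lt_ncard_iff (Set.toFinite _)).2 ⟨⟨i, ⟨0, by omega⟩⟩, ⟨i, ⟨1, by omega⟩⟩,
      ⟨i, ⟨2, by omega⟩⟩, ?_, ?_, ?_, ?_, ?_, ?_⟩ <;> simp
  · obtain ⟨t, ht, hne, hZ⟩ := exists_explicitPauli_eq_Z (hdeg i).2 p
    refine two_le_wt (hlt i p) ht (Ne.symm hne) ?_ ?_ <;> rw [explicitLabels_apply]
    · rcases explicitPauli_pos (G.degree i) p with h | h <;> rw [h] <;> decide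
    · rw [hZ]; decide
  · obtain ⟨t, ht, hne, hI⟩ := exists_explicitPauli_eq_I (hdeg i).2 p
    rw [localComb_explicitLabels hdeg]
    refine two_le_wt (hlt i p) ht (Ne.symm hne) ?_ ?_ <;>
      rw [Pi.add_apply, explicitLabels_apply, if_pos rfl]
    · rcases explicitPauli_pos (G.degree i) p with h | h <;> rw [h] <;> decide
    · rw [hI]; decide
  · rw [localComb_explicitLabels hdeg]
    -- Modes sharing a position agree elsewhere, so they cancel there and leave the `Z` of the
    -- vertex operator. For different positions, `X` or `Y` survives at each of the two, as it is
    -- only multiplied by `Z` or `I`.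
    by_cases h : explicitPos (G.degree i) p = explicitPos (G.degree i) q
    · obtain ⟨t, ht, hne, hZ⟩ := exists_explicitPauli_eq_Z (hdeg i).2 p
      obtain ⟨u, hu, hne', hI⟩ := exists_explicitPauli_eq_I (hdeg i).2 p
      have htu : t ≠ u := by
        rintro rfl
        rw [hZ] at hI
        exact absurd hI (by decide)
      have hsame : ∀ s, s ≠ explicitPos (G.degree i) p →
          explicitPauli (G.degree i) q s = explicitPauli (G.degree i) p s := by
        intro s hs
        rw [explicitPauli_eq, explicitPauli_eq, ← h, if_neg hs, if_neg hs]
      refine two_le_wt ht hu htu ?_ ?_ <;>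
        rw [Pi.add_apply, Pi.add_apply, explicitLabels_apply, explicitLabels_apply, if_pos rfl]
      · rw [hsame t hne, hZ]; decide
      · rw [hsame u hne', hI]; decide
    · refine two_le_wt (hlt i p) (hlt i q) h ?_ ?_ <;>
        rw [Pi.add_apply, Pi.add_apply, explicitLabels_apply, explicitLabels_apply, if_pos rfl]
      · rcases explicitPauli_pos (G.degree i) p with h1 | h1 <;>
          rcases explicitPauli_of_ne h with h2 | h2 <;> rw [h1, h2] <;> decide
      · rcases explicitPauli_pos (G.degree i) q with h1 | h1 <;>
          rcases explicitPauli_of_ne (Ne.symm h) with h2 | h2 <;> rw [h1, h2] <;> decide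

end Multigraph

end GSE

theorem theorem1 {V E : Type*} [Fintype V] [DecidableEq V] [Finite E]
    (G : GSE.Multigraph V E)
    (hconn : G.ThreeConnected)
    (hdeg : ∀ i, Even (G.degree i) ∧ 6 ≤ G.degree i)
    (hmult : ∀ i j, {e | G.Joins e i j}.ncard ≤ 2)
    (L : G.Labelling) :
    -- the explicit modes are admissible, satisfy the weight conditions, and give a stabilizer code
    -- that corrects all single-qubit errors
    (G.IsLocalMajorana G.explicitModes ∧
      GSE.Multigraph.WeightConditions G.explicitModes ∧
      GSE.IsStabilizerGroup (GSE.Multigraph.stabilizer L G.explicitModes) ∧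
      GSE.CorrectsSingleQubitErrors (GSE.Multigraph.stabilizer L G.explicitModes)) ∧
    -- so does every choice of local Majorana modes that satisfies the weight conditions
    (∀ γ : G.Modes, G.IsLocalMajorana γ → GSE.Multigraph.WeightConditions γ →
      GSE.IsStabilizerGroup (GSE.Multigraph.stabilizer L γ) ∧
      GSE.CorrectsSingleQubitErrors (GSE.Multigraph.stabilizer L γ)) := by
  have heven := fun i => (hdeg i).1
  have hgen : ∀ γ : G.Modes, G.IsLocalMajorana γ → GSE.Multigraph.WeightConditions γ →
      GSE.IsStabilizerGroup (GSE.Multigraph.stabilizer L γ) ∧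
      GSE.CorrectsSingleQubitErrors (GSE.Multigraph.stabilizer L γ) := fun γ h hW =>
    ⟨GSE.Multigraph.isStabilizerGroup h L heven,
      GSE.Multigraph.correctsSingleQubitErrors hconn heven hmult h hW L⟩
  have hM := GSE.Multigraph.isLocalMajorana_explicitModes hdeg
  have hW := (GSE.Multigraph.weightConditions_iff GSE.Multigraph.hasLabel_explicitModes).2
    (GSE.Multigraph.labelConditions_explicitLabels hdeg)
  exact ⟨⟨hM, hW, hgen _ hM hW⟩, hgen⟩
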